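/- Consider bosonic systems with finitely many modes: the Hilbert space of $m$ modes is $L^2(\mathbb R^m)$, with quadratures $\mathbf R=(\mathbf x_1,\mathbf p_1,\dots,\mathbf x_m,\mathbf p_m)^\top$, $[\mathbf x_j,\mathbf p_k]=i\delta_{jk}$, symplectic form $\Omega=\bigoplus_{j}\begin{pmatrix}0&1\\-1&0\end{pmatrix}$ and displacement operators $D_{\mathbf r}=e^{-i\mathbf r^\top\Omega\mathbf R}$, $\mathbf r\in\mathbb R^{2m}$. A state (density operator) $\rho$ is Gaussian if its Wigner function $$W(\mathbf s)=\frac1{(2\pi)^{2m}}\int_{\mathbb R^{2m}}\mathrm{tr}(\rho D_{\mathbf r})\,e^{i\mathbf r^\top\Omega\mathbf s}\,\mathrm d\mathbf r$$ is a Gaussian density $\frac{1}{\pi^m\sqrt{\det\boldsymbol\gamma}}e^{-(\mathbf s-\mathbf d)^\top\boldsymbol\gamma^{-1}(\mathbf s-\mathbf d)}$ for some $\mathbf d\in\mathbb R^{2m}$ and some positive definite $\boldsymbol\gamma$. Write $\mathbf d(\rho)=\mathrm{tr}(\rho\mathbf R)$ for the first moments and $\boldsymbol\gamma(\rho)=\mathrm{tr}[\rho\{\mathbf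 R-\mathbf d(\rho),(\mathbf R-\mathbf d(\rho))^\top\}]$ (entrywise anticommutators) for the covariance matrix. For a bipartite Gaussian state $\rho_{AB}$, where $A$ and $B$ have any positive numbers of modes, the Gaussian maximal correlation is $$\mu_G(A,B)=\sup_{X_A,Y_B}\mathrm{tr}(\rho_{AB}\,X_A\otimes Y_B),$$ where the supremum is over Hermitian operators that are linear in the local quadratures, $X_A=\mathbf r_A^\top\mathbf R_A+c_A I$ and $Y_B=\mathbf r_B^\top\mathbf R_B+c_B I$ with real $\mathbf r_A,\mathbf r_B,c_A,c_B$, subject to $\mathrm{tr}(\rho_AX_A)=\mathrm{tr}(\rho_BY_B)=0$ and $\mathrm{tr}(\rho_AX_A^2)=\mathrm{tr}(\rho_BY_B^2)=1$. (If $\mathbf d(\rho_{AB})=0$, the constraints force $c_A=c_B=0$.) 1. For every bipartite Gaussian state $\rho_{AB}$ all operators $\mathbf u^\top\mathbf R$ (with $\mathbf u$ real) have finite second moments, the covariance matrix $$\boldsymbol\gamma(\rho_{AB})=\begin{pmatrix}\boldsymbol\gamma_A&\boldsymbol\nu_{AB}\\ \boldsymbol\nu_{AB}^\top&\boldsymbol\gamma_B\end{pmatrix}$$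 is positive definite, the supremum is attained, and, with the operator norm for Euclidean norms, $$\mu_G(A,B)=\|\boldsymbol\gamma_A^{-1/2}\boldsymbol\nu_{AB}\boldsymbol\gamma_B^{-1/2}\|.$$ 2. If $A$ and $B$ are single modes and $\boldsymbol\gamma(\rho_{AB})$ is in the standard form $\boldsymbol\gamma_A=\lambda_AI$, $\boldsymbol\gamma_B=\lambda_BI$, $\boldsymbol\nu_{AB}=\mathrm{diag}(\nu_1,\nu_2)$ with $|\nu_1|\ge|\nu_2|$, then $$\mu_G(A,B)=\frac{|\nu_1|}{\sqrt{\lambda_A\lambda_B}}.$$ 3. (Tensorization.) For any finite family of density operators $\rho_{A_iB_i}$ there is exactly one density operator $\tau=\bigotimes_i\rho_{A_iB_i}$ on the joint system with $\tau(\bigotimes_if_i)=\bigotimes_i\rho_{A_iB_i}f_i$ for all product vectors. If the family is nonempty, each $A_i$ and $B_i$ has at least one mode, and each $\rho_{A_iB_i}$ is Gaussian, then $\tau$, as a bipartite state of $A=\bigotimes_iA_i$ and $B=\bigotimes_iB_i$, is Gaussian, $\boldsymbol\gamma(\tau)=\bigoplus_i\boldsymbol\gamma(\rho_{A_iB_i})$,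 and $\mu_G(A,B)=\max_i\mu_G(A_i,B_i)$. In particular, $\mu_G(A^n,B^n)=\mu_G(A,B)$ for the state $\rho_{AB}^{\otimes n}$, for every $n\ge1$ and every bipartite Gaussian state $\rho_{AB}$. -/

import Mathlib

open MeasureTheory Matrix
open scoped InnerProductSpace Kronecker MatrixOrder

noncomputable section

namespace GaussianCorrelation

/-! ### Continuous-variable systems, displacement operators and quadratures

The modes of a system are labelled by a finite type `α`; its Hilbert space is `L²(ℝ^α)`. Phase-space
vectors are indexed by `α × Fin 2`: `(j, 0)` is the `x`-coordinate and `(j, 1)` the `p`-coordinate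
of mode `j`. -/

/-- The Hilbert space `L²(ℝ^α; ℂ)` of a bosonic system with set of modes `α`. -/
abbrev HilbertSpace (α : Type) [Fintype α] : Type :=
  Lp ℂ 2 (volume : Measure (α → ℝ))

/-- The phase space of the system with set of modes `α`. -/
abbrev PhaseSpace (α : Type) : Type := α × Fin 2 → ℝ

section System

variable {α : Type} [Fintype α]

/-- The symplectic form `Ω`, block diagonal with one block `(0 1; -1 0)` for each mode. -/
def Omega (α : Type) [DecidableEq α] : Matrix (α × Fin 2) (α × Fin 2) ℝ :=
  (1 : Matrix α α ℝ) ⊗ₖ !![0, 1; -1, 0]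

/-- The phase `p · x - (p · q) / 2`, for the phase-space vector `r` with coordinates `(q, p)`. -/
def phase (r : PhaseSpace α) (x : α → ℝ) : ℝ :=
  ∑ j, r (j, 1) * x j - (∑ j, r (j, 1) * r (j, 0)) / 2

/-- The function `exp (i (p · x - (p · q) / 2))`. -/
def phaseFactor (r : PhaseSpace α) (x : α → ℝ) : ℂ :=
  Complex.exp (Complex.I * (phase r x : ℂ))

lemma continuous_phaseFactor (r : PhaseSpace α) : Continuous (phaseFactor r) := by
  unfold phaseFactor phase
  fun_prop

lemma norm_phaseFactor (r : PhaseSpace α) (x : α → ℝ) : ‖phaseFactor r x‖ = 1 := by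
  rw [phaseFactor, mul_comm, Complex.norm_exp_ofReal_mul_I]

lemma memLp_phaseFactor_mul (r : PhaseSpace α) (ψ : HilbertSpace α) :
    MemLp (fun x => phaseFactor r x * ψ x) 2 (volume : Measure (α → ℝ)) := by
  refine (Lp.memLp ψ).of_le
    ((continuous_phaseFactor r).aestronglyMeasurable.mul (Lp.aestronglyMeasurable ψ)) ?_
  exact Filter.Eventually.of_forall fun x => by rw [norm_mul, norm_phaseFactor, one_mul]

/-- Multiplication by `exp (i (p · x - (p · q) / 2))`, as an isometry of `L²`. -/
def phaseMul (r : PhaseSpace α) : HilbertSpace α →ₗᵢ[ℂ] HilbertSpace α where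
  toFun ψ := (memLp_phaseFactor_mul r ψ).toLp _
  map_add' ψ φ := by
    apply Lp.ext
    filter_upwards [(memLp_phaseFactor_mul r (ψ + φ)).coeFn_toLp,
      (memLp_phaseFactor_mul r ψ).coeFn_toLp, (memLp_phaseFactor_mul r φ).coeFn_toLp,
      Lp.coeFn_add ((memLp_phaseFactor_mul r ψ).toLp _) ((memLp_phaseFactor_mul r φ).toLp _),
      Lp.coeFn_add ψ φ] with x h1 h2 h3 h4 h5
    rw [h1, h4, Pi.add_apply, h2, h3, h5, Pi.add_apply, mul_add]
  map_smul' c ψ := by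
    apply Lp.ext
    filter_upwards [(memLp_phaseFactor_mul r (c • ψ)).coeFn_toLp,
      (memLp_phaseFactor_mul r ψ).coeFn_toLp,
      Lp.coeFn_smul c ((memLp_phaseFactor_mul r ψ).toLp _), Lp.coeFn_smul c ψ] with x h1 h2 h3 h4
    simp only [RingHom.id_apply]
    rw [h1, h3, Pi.smul_apply, h2, h4, Pi.smul_apply, smul_eq_mul, smul_eq_mul, mul_left_comm]
  norm_map' ψ := by
    refine (Lp.norm_toLp _ (memLp_phaseFactor_mul r ψ)).trans ?_
    rw [Lp.norm_def]
    congr 1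
    exact eLpNorm_congr_norm_ae (Filter.Eventually.of_forall fun x => by
      rw [norm_mul, norm_phaseFactor, one_mul])

/-- The translation `ψ ↦ ψ (· - q)`, where `q` is the position part of `r`. -/
def translate (r : PhaseSpace α) : HilbertSpace α →ₗᵢ[ℂ] HilbertSpace α :=
  Lp.compMeasurePreservingₗᵢ ℂ (fun x : α → ℝ => x - fun j => r (j, 0))
    (measurePreserving_sub_right volume fun j => r (j, 0))

/-- The displacement (Weyl) operator `D_r = exp (-i rᵀ Ω R) = exp (i ∑ⱼ (pⱼ xⱼ - qⱼ pⱼ))` for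
`r = (q, p)`, in the Schrödinger representation:
`(D_r ψ)(x) = exp (i (p · x - (p · q) / 2)) ψ (x - q)`. -/
def displacement (r : PhaseSpace α) : HilbertSpace α →L[ℂ] HilbertSpace α :=
  ((phaseMul r).comp (translate r)).toContinuousLinearMap

lemma coeFn_displacement (r : PhaseSpace α) (ψ : HilbertSpace α) :
    displacement r ψ =ᵐ[volume]
      fun x => Complex.exp (Complex.I * (phase r x : ℂ)) * ψ (x - fun j => r (j, 0)) := by
  have h1 := (memLp_phaseFactor_mul r (translate r ψ)).coeFn_toLp
  have h2 := Lp.coeFn_compMeasurePreserving ψ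
    (measurePreserving_sub_right (volume : Measure (α → ℝ)) fun j => r (j, 0))
  filter_upwards [h1, h2] with x h1 h2
  refine h1.trans ?_
  change phaseFactor r x * _ = phaseFactor r x * _
  congr 1

variable [DecidableEq α]

/-- The self-adjoint operator `uᵀ R = ∑ₖ uₖ Rₖ`, a real linear combination of the quadratures
`R = (x₁, p₁, …)`, as the Stone generator of the unitary group `t ↦ exp (i t uᵀ R) = D_{-t Ω u}`:
its domain is the set of `ψ` for which `t ↦ D_{-t Ω u} ψ` is differentiable at `0`, and its value
there is `-i` times the derivative. For `u` the unit vector at `(j, 0)` this is multiplication by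
`xⱼ`, for the unit vector at `(j, 1)` it is `-i ∂/∂xⱼ`. -/
def quadrature (u : PhaseSpace α) : HilbertSpace α →ₗ.[ℂ] HilbertSpace α where
  domain :=
    { carrier := {ψ | DifferentiableAt ℝ (fun t : ℝ => displacement (-(t • (Omega α *ᵥ u))) ψ) 0}
      zero_mem' := by simp
      add_mem' := fun {ψ φ} hψ hφ => by
        simp only [Set.mem_ofPred_eq, map_add] at *
        exact hψ.add hφ
      smul_mem' := fun c ψ hψ => by
        simp only [Set.mem_ofPred_eq, map_smul] at *
        exact hψ.const_smul c }
  toFun :=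
    { toFun := fun ψ => -Complex.I •
        deriv (fun t : ℝ => displacement (-(t • (Omega α *ᵥ u))) (ψ : HilbertSpace α)) 0
      map_add' := fun ψ φ => by
        simp only [Submodule.coe_add, map_add]
        rw [deriv_fun_add ψ.2 φ.2, smul_add]
      map_smul' := fun c ψ => by
        simp only [Submodule.coe_smul, map_smul, RingHom.id_apply]
        rw [deriv_fun_const_smul c ψ.2, smul_comm] }

/-- The Hermitian operator `uᵀ R + c I`, with `u` and `c` real, on the domain of `uᵀ R`. -/
def linearObservable (u : PhaseSpace α) (c : ℝ) : HilbertSpace α →ₗ.[ℂ] HilbertSpace α :=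
  ((c : ℂ) • (LinearMap.id : HilbertSpace α →ₗ[ℂ] HilbertSpace α)) +ᵥ quadrature u

end System

/-! ### States, traces and moments -/

section States

/-- The positive square root of a positive bounded operator on a complex Hilbert space. -/
def operatorSqrt {H : Type} [NormedAddCommGroup H] [InnerProductSpace ℂ H] [CompleteSpace H]
    (T : H →L[ℂ] H) : H →L[ℂ] H :=
  CFC.sqrt T

variable {α : Type} [Fintype α]

/-- A Hilbert basis of `L²(ℝ^α)`, used to compute traces. -/
def traceBasis (α : Type) [Fintype α] :
    HilbertBasis (exists_hilbertBasis ℂ (HilbertSpace α)).choose ℂ (HilbertSpace α) :=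
  (exists_hilbertBasis ℂ (HilbertSpace α)).choose_spec.choose

/-- The trace `tr T = ∑ᵢ ⟪bᵢ, T bᵢ⟫`. For a trace-class `T` the sum converges absolutely and does
not depend on the Hilbert basis `b`. -/
def trace (T : HilbertSpace α →L[ℂ] HilbertSpace α) : ℂ :=
  ∑' i, ⟪traceBasis α i, T (traceBasis α i)⟫_ℂ

/-- Density operators: positive bounded operators with trace one. -/
@[ext]
structure DensityOperator (α : Type) [Fintype α] where
  op : HilbertSpace α →L[ℂ] HilbertSpace α
  isPositive : op.IsPositive
  hasSum_trace : HasSum (fun i => ⟪traceBasis α i, op (traceBasis α i)⟫_ℂ) 1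

/-- The positive square root of a density operator. -/
def DensityOperator.sqrt (ρ : DensityOperator α) : HilbertSpace α →L[ℂ] HilbertSpace α :=
  operatorSqrt ρ.op

open Classical in
/-- The value `X ψ` of an unbounded operator, extended by `0` outside its domain. -/
def applyOp (X : HilbertSpace α →ₗ.[ℂ] HilbertSpace α) (ψ : HilbertSpace α) : HilbertSpace α :=
  if h : ψ ∈ X.domain then X ⟨ψ, h⟩ else 0

/-- `X` has a finite second moment in the state `ρ`: `X ρ^{1/2}` is everywhere defined and
Hilbert-Schmidt, that is `tr (ρ X† X) < ∞`. -/
def HasSecondMoment (ρ : DensityOperator α) (X : HilbertSpace α →ₗ.[ℂ] HilbertSpace α) : Prop :=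
  (∀ ψ, ρ.sqrt ψ ∈ X.domain) ∧
    Summable fun i => ‖applyOp X (ρ.sqrt (traceBasis α i))‖ ^ 2

/-- The expectation `tr (ρ X) = tr (ρ^{1/2} X ρ^{1/2})` of an operator with a finite second
moment. -/
def expectation (ρ : DensityOperator α) (X : HilbertSpace α →ₗ.[ℂ] HilbertSpace α) : ℂ :=
  ∑' i, ⟪ρ.sqrt (traceBasis α i), applyOp X (ρ.sqrt (traceBasis α i))⟫_ℂ

/-- The expectation `tr (ρ X† Y) = tr ((X ρ^{1/2})† (Y ρ^{1/2}))` of a product of two operators with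
finite second moments. -/
def expectationMul (ρ : DensityOperator α) (X Y : HilbertSpace α →ₗ.[ℂ] HilbertSpace α) : ℂ :=
  ∑' i, ⟪applyOp X (ρ.sqrt (traceBasis α i)), applyOp Y (ρ.sqrt (traceBasis α i))⟫_ℂ

variable [DecidableEq α]

/-- The vector of first moments, `d(ρ)ₖ = tr (ρ Rₖ)`. -/
def firstMoment (ρ : DensityOperator α) : PhaseSpace α :=
  fun k => (expectation ρ (quadrature (Pi.single k 1))).re

/-- The centred quadrature `Rₖ - d(ρ)ₖ`. -/
def centredQuadrature (ρ : DensityOperator α) (k : α × Fin 2) :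
    HilbertSpace α →ₗ.[ℂ] HilbertSpace α :=
  linearObservable (Pi.single k 1) (-firstMoment ρ k)

/-- The covariance matrix, `γ(ρ)ₖₗ = tr (ρ {Rₖ - d(ρ)ₖ, Rₗ - d(ρ)ₗ})`, with the anticommutator
`{X, Y} = X Y + Y X`. -/
def covarianceMatrix (ρ : DensityOperator α) : Matrix (α × Fin 2) (α × Fin 2) ℝ :=
  Matrix.of fun k l =>
    (expectationMul ρ (centredQuadrature ρ k) (centredQuadrature ρ l) +
      expectationMul ρ (centredQuadrature ρ l) (centredQuadrature ρ k)).re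

/-- The characteristic function `χ(r) = tr (ρ D_r)`. -/
def characteristicFunction (ρ : DensityOperator α) (r : PhaseSpace α) : ℂ :=
  trace (ρ.op ∘L displacement r)

/-- The Wigner function `W(s) = (2π)^{-2m} ∫ χ(r) exp (i rᵀ Ω s) dr` of an `m`-mode state. -/
def wignerFunction (ρ : DensityOperator α) (s : PhaseSpace α) : ℂ :=
  (((2 * Real.pi) ^ (2 * Fintype.card α) : ℝ) : ℂ)⁻¹ *
    ∫ r : PhaseSpace α, characteristicFunction ρ r *
      Complex.exp (Complex.I * ((r ⬝ᵥ (Omega α *ᵥ s) : ℝ) : ℂ))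

/-- A state is Gaussian if its Wigner function is a (nondegenerate, normalized) Gaussian density
`exp (-(s - d)ᵀ γ⁻¹ (s - d)) / (π^m √(det γ))`. -/
def IsGaussian (ρ : DensityOperator α) : Prop :=
  ∃ (d : PhaseSpace α) (γ : Matrix (α × Fin 2) (α × Fin 2) ℝ), γ.PosDef ∧
    ∀ s : PhaseSpace α, wignerFunction ρ s =
      ((Real.exp (-((s - d) ⬝ᵥ (γ⁻¹ *ᵥ (s - d)))) /
        (Real.pi ^ Fintype.card α * Real.sqrt γ.det) : ℝ) : ℂ)

end States

/-! ### Bipartite systems and the Gaussian maximal correlation -/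

section Bipartite

variable {α β : Type}

/-- Coefficients of quadratures of `A`, as coefficients of quadratures of `AB`. -/
def leftCoeff (r : PhaseSpace α) : PhaseSpace (α ⊕ β) :=
  fun k => Sum.elim (fun a => r (a, k.2)) (fun _ => 0) k.1

/-- Coefficients of quadratures of `B`, as coefficients of quadratures of `AB`. -/
def rightCoeff (r : PhaseSpace β) : PhaseSpace (α ⊕ β) :=
  fun k => Sum.elim (fun _ => 0) (fun b => r (b, k.2)) k.1

/-- The block `γ_A` of a matrix indexed by the quadratures of `AB`. -/
def blockA (γ : Matrix ((α ⊕ β) × Fin 2) ((α ⊕ β) × Fin 2) ℝ) :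
    Matrix (α × Fin 2) (α × Fin 2) ℝ :=
  γ.submatrix (Prod.map Sum.inl id) (Prod.map Sum.inl id)

/-- The block `γ_B`. -/
def blockB (γ : Matrix ((α ⊕ β) × Fin 2) ((α ⊕ β) × Fin 2) ℝ) :
    Matrix (β × Fin 2) (β × Fin 2) ℝ :=
  γ.submatrix (Prod.map Sum.inr id) (Prod.map Sum.inr id)

/-- The off-diagonal block `ν_AB`. -/
def blockAB (γ : Matrix ((α ⊕ β) × Fin 2) ((α ⊕ β) × Fin 2) ℝ) :
    Matrix (α × Fin 2) (β × Fin 2) ℝ :=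
  γ.submatrix (Prod.map Sum.inl id) (Prod.map Sum.inr id)

/-- `γ^{-1/2}` for a positive definite matrix. -/
def invSqrt {n : Type} [Fintype n] [DecidableEq n] (γ : Matrix n n ℝ) : Matrix n n ℝ :=
  (CFC.sqrt γ)⁻¹

/-- The operator norm of a matrix with respect to the Euclidean norms. -/
def matrixOpNorm {m n : Type} [Fintype m] [Fintype n] [DecidableEq n] (M : Matrix m n ℝ) : ℝ :=
  ‖(Matrix.toEuclideanLin M).toContinuousLinearMap‖

variable [Fintype α] [DecidableEq α] [Fintype β] [DecidableEq β]

/-- The operator `X_A ⊗ I`, where `X_A = rᵀ R_A + c I`. -/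
def observableA (r : PhaseSpace α) (c : ℝ) :
    HilbertSpace (α ⊕ β) →ₗ.[ℂ] HilbertSpace (α ⊕ β) :=
  linearObservable (leftCoeff r) c

/-- The operator `I ⊗ Y_B`, where `Y_B = rᵀ R_B + c I`. -/
def observableB (r : PhaseSpace β) (c : ℝ) :
    HilbertSpace (α ⊕ β) →ₗ.[ℂ] HilbertSpace (α ⊕ β) :=
  linearObservable (rightCoeff r) c

/-- The constraints on a local observable: `Z` has finite second moment, zero mean and unit second
moment. For `Z = X_A ⊗ I` the expectations are those of `X_A` in the marginal state `ρ_A`, since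
`tr (ρ_A T) = tr (ρ_AB (T ⊗ I))`; similarly for `Z = I ⊗ Y_B`. -/
def IsStandardized {κ : Type} [Fintype κ] (ρ : DensityOperator κ)
    (Z : HilbertSpace κ →ₗ.[ℂ] HilbertSpace κ) : Prop :=
  HasSecondMoment ρ Z ∧ expectation ρ Z = 0 ∧ expectationMul ρ Z Z = 1

/-- The set of values `tr (ρ_AB X_A ⊗ Y_B)` for Hermitian `X_A`, `Y_B` that are linear in the
quadratures of `A` and of `B` and satisfy `tr (ρ_A X_A) = tr (ρ_B Y_B) = 0` and
`tr (ρ_A X_A²) = tr (ρ_B Y_B²) = 1`. -/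
def correlationValues (ρ : DensityOperator (α ⊕ β)) : Set ℝ :=
  {v | ∃ (rA : PhaseSpace α) (cA : ℝ) (rB : PhaseSpace β) (cB : ℝ),
    IsStandardized ρ (observableA rA cA) ∧ IsStandardized ρ (observableB rB cB) ∧
      (v : ℂ) = expectationMul ρ (observableA rA cA) (observableB rB cB)}

/-- The Gaussian maximal correlation `μ_G(A, B)`. -/
def gaussianMaximalCorrelation (ρ : DensityOperator (α ⊕ β)) : ℝ :=
  sSup (correlationValues ρ)

/-- The covariance matrix of a two-mode state in standard form: diagonal blocks `λ_A I`, `λ_B I` and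
off-diagonal block `diag (ν₁, ν₂)`. -/
def standardForm (lamA lamB ν₁ ν₂ : ℝ) :
    Matrix ((Unit ⊕ Unit) × Fin 2) ((Unit ⊕ Unit) × Fin 2) ℝ :=
  Matrix.of fun k l =>
    match k, l with
    | (Sum.inl _, i), (Sum.inl _, j) => (lamA • (1 : Matrix (Fin 2) (Fin 2) ℝ)) i j
    | (Sum.inl _, i), (Sum.inr _, j) => Matrix.diagonal ![ν₁, ν₂] i j
    | (Sum.inr _, i), (Sum.inl _, j) => Matrix.diagonal ![ν₁, ν₂] i j
    | (Sum.inr _, i), (Sum.inr _, j) => (lamB • (1 : Matrix (Fin 2) (Fin 2) ℝ)) i j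

end Bipartite

/-! ### Tensor products of bipartite states -/

section Tensor

variable {ι : Type} [Fintype ι] {α β : ι → Type}

/-- The embedding of the modes of the `i`-th bipartite system `AᵢBᵢ` into those of the bipartite
system with parts `⨂ᵢ Aᵢ` and `⨂ᵢ Bᵢ`. -/
def modeEmb (i : ι) : α i ⊕ β i → (Σ i, α i) ⊕ (Σ i, β i) :=
  Sum.map (Sigma.mk i) (Sigma.mk i)

variable [∀ i, Fintype (α i)] [∀ i, Fintype (β i)]

/-- `F` is the product vector `⨂ᵢ fᵢ`, that is `F(x) = ∏ᵢ fᵢ(xᵢ)` with `xᵢ` the coordinates of the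
modes of the `i`-th system. -/
def IsProductVector (f : ∀ i, HilbertSpace (α i ⊕ β i))
    (F : HilbertSpace ((Σ i, α i) ⊕ (Σ i, β i))) : Prop :=
  F =ᵐ[volume] fun x => ∏ i, f i (fun k => x (modeEmb i k))

/-- `τ` is the tensor product `⨂ᵢ ρᵢ`, considered as a bipartite state of `⨂ᵢ Aᵢ` and `⨂ᵢ Bᵢ`: it
maps each product vector `⨂ᵢ fᵢ` to `⨂ᵢ ρᵢ fᵢ`. -/
def IsTensorProduct (ρ : ∀ i, DensityOperator (α i ⊕ β i))
    (τ : DensityOperator ((Σ i, α i) ⊕ (Σ i, β i))) : Prop :=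
  ∀ (f : ∀ i, HilbertSpace (α i ⊕ β i)) (F : HilbertSpace ((Σ i, α i) ⊕ (Σ i, β i))),
    IsProductVector f F → IsProductVector (fun i => (ρ i).op (f i)) (τ.op F)

/-- The direct sum `⨁ᵢ γᵢ`: the entry is `(γᵢ)ₖₗ` for quadratures `k`, `l` of the same system `i`,
and `0` for quadratures of different systems. -/
def IsDirectSum (γ : ∀ i, Matrix ((α i ⊕ β i) × Fin 2) ((α i ⊕ β i) × Fin 2) ℝ)
    (Γ : Matrix (((Σ i, α i) ⊕ (Σ i, β i)) × Fin 2) (((Σ i, α i) ⊕ (Σ i, β i)) × Fin 2) ℝ) :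
    Prop :=
  (∀ i k l, Γ (Prod.map (modeEmb i) id k) (Prod.map (modeEmb i) id l) = γ i k l) ∧
    ∀ i j, i ≠ j → ∀ k l, Γ (Prod.map (modeEmb i) id k) (Prod.map (modeEmb j) id l) = 0

end Tensor

end GaussianCorrelation

end

namespace GaussianCorrelation

/-! ### Ensembles of vectors and traces -/

section Ensemble

variable {H : Type*} [NormedAddCommGroup H] [InnerProductSpace ℂ H] {J K : Type*}

/-! Everything is read off from the characteristic function. If the Wigner function is a Gaussian
density with parameters `d`, `γ`, Fourier inversion gives `χ(-Ωw) = exp (i w·d - wᵀγw/4)`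
(`exists_hasGaussianChar_of_wignerFunction`); conversely, such a `χ` forces a Gaussian Wigner
function (`isGaussian_of_hasGaussianChar`).

The analytic point is that `χ` also controls the unbounded quadratures. A Hilbert-Schmidt operator
is treated as the square-summable family of its values on a Hilbert basis. By the Weyl relations,
inner products of the families `D_{-tΩu} ρ^{1/2}` and `D_{-sΩv} ρ^{1/2}` are explicit phases times
values of `χ`. Inner products of difference quotients therefore converge as the two parameters tend
to zero independently, which makes the quotients Cauchy. Their limit is `i (uᵀR) ρ^{1/2}`: this
gives domains, finite second moments and all mixed moments at once (`exists_hasDerivAt_weylCurve`,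
`exists_family_linearObservable`). In particular `d` and `γ` are the actual moments of `ρ`.

Quadratures of `A` and `B` commute, so the correlation values are `xᵀ ν y / 2` under `xᵀ γ_A x = yᵀ
γ_B y = 2` (`correlationValues_eq`). Whitening both variables by square roots turns the supremum
into an operator norm, attained by compactness (`isGreatest_normalizedValues`). In standard form,
Cauchy-Schwarz in the plane evaluates it.

For tensor products, the products of the vectors `ρᵢ^{1/2} b` form an ensemble of a state acting
correctly on product vectors, and product vectors are total, whence existence and uniqueness.
Displacements factor over the subsystems, so characteristic functions multiply and covariance
matrices add as direct sums. A bilinear form on a direct sum obeys the worst blockwise bound, by one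
more Cauchy-Schwarz inequality over the blocks (`isGreatest_normalizedValues_directSum`). -/

lemma inner_self_eq_ofReal_norm_sq (x : H) : ⟪x, x⟫_ℂ = ((‖x‖ ^ 2 : ℝ) : ℂ) := by
  rw [inner_self_eq_norm_sq_to_K]
  simp

lemma hasSum_norm_inner_sq (b : HilbertBasis K ℂ H) (x : H) :
    HasSum (fun k => ‖⟪b k, x⟫_ℂ‖ ^ 2) (‖x‖ ^ 2) := by
  have h := (b.hasSum_inner_mul_inner x x).mapL Complex.reCLM
  have e : Complex.reCLM ⟪x, x⟫_ℂ = ‖x‖ ^ 2 := by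
    rw [inner_self_eq_ofReal_norm_sq, Complex.reCLM_apply, Complex.ofReal_re]
  rw [e] at h
  convert h using 2 with k
  rw [← inner_conj_symm x (b k), ← Complex.normSq_eq_conj_mul_self]
  rw [Complex.reCLM_apply, Complex.ofReal_re, Complex.normSq_eq_norm_sq]

/-- The operator `T` is the sum `∑ⱼ |vⱼ⟩⟨vⱼ|` for a square-summable family of vectors `v`. -/
structure IsEnsemble (v : J → H) (T : H →L[ℂ] H) : Prop where
  summable : Summable fun j => ‖v j‖ ^ 2
  hasSum : ∀ x y, HasSum (fun j => ⟪x, v j⟫_ℂ * ⟪v j, y⟫_ℂ) ⟪x, T y⟫_ℂ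

/-- Parseval in `k` collapses the double sum to `∑ ‖wⱼ‖²`. This supplies the absolute convergence
needed to exchange sums in trace computations. -/
lemma summable_norm_inner_sq_prod (b : HilbertBasis K ℂ H) {w : J → H}
    (hw : Summable fun j => ‖w j‖ ^ 2) :
    Summable fun p : J × K => ‖⟪b p.2, w p.1⟫_ℂ‖ ^ 2 := by
  refine (summable_prod_of_nonneg fun p => by positivity).2
    ⟨fun j => (hasSum_norm_inner_sq b (w j)).summable, ?_⟩
  simpa only [(hasSum_norm_inner_sq b _).tsum_eq] using hw

/-- The trace of `T U` in any Hilbert basis, for `T = ∑ⱼ |vⱼ⟩⟨vⱼ|`. -/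
lemma IsEnsemble.hasSum_trace [CompleteSpace H] {v : J → H} {T : H →L[ℂ] H} (h : IsEnsemble v T)
    (b : HilbertBasis K ℂ H) (U : H →L[ℂ] H) :
    HasSum (fun k => ⟪b k, T (U (b k))⟫_ℂ) (∑' j, ⟪v j, U (v j)⟫_ℂ) := by
  -- Moving `U` to the other side makes the double series a product of two square-summable arrays,
  -- hence absolutely summable; summing it in the two orders gives the two sides.
  set w : J → H := fun j => ContinuousLinearMap.adjoint U (v j) with hw
  have hws : Summable fun j => ‖w j‖ ^ 2 := by
    refine Summable.of_nonneg_of_le (fun j => by positivity) (fun j => ?_)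
      (h.summable.mul_left (‖ContinuousLinearMap.adjoint U‖ ^ 2))
    rw [← mul_pow]
    gcongr
    exact ContinuousLinearMap.le_opNorm _ _
  have hF : Summable fun p : J × K => ⟪w p.1, b p.2⟫_ℂ * ⟪b p.2, v p.1⟫_ℂ := by
    refine Summable.of_norm_bounded ((summable_norm_inner_sq_prod b hws).add
      (summable_norm_inner_sq_prod b h.summable)) fun p => ?_
    rw [norm_mul, ← norm_inner_symm (b p.2) (w p.1)]
    nlinarith [sq_nonneg (‖⟪b p.2, w p.1⟫_ℂ‖ - ‖⟪b p.2, v p.1⟫_ℂ‖),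
      sq_nonneg (‖⟪b p.2, w p.1⟫_ℂ‖ + ‖⟪b p.2, v p.1⟫_ℂ‖)]
  have h1 : HasSum (fun j => ⟪v j, U (v j)⟫_ℂ) (∑' p : J × K, ⟪w p.1, b p.2⟫_ℂ * ⟪b p.2, v p.1⟫_ℂ) :=
    hF.hasSum.prod_fiberwise fun j => by
      have := b.hasSum_inner_mul_inner (w j) (v j)
      rwa [hw, ContinuousLinearMap.adjoint_inner_left] at this
  rw [h1.tsum_eq]
  have h2 := (Equiv.prodComm K J).hasSum_iff.2 hF.hasSum
  refine h2.prod_fiberwise fun k => ?_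
  have := h.hasSum (b k) (U (b k))
  refine this.congr_fun ?_
  intro j
  simp only [Function.comp, Equiv.prodComm_apply, Prod.swap, hw,
    ContinuousLinearMap.adjoint_inner_left]
  ring

lemma IsEnsemble.isPositive [CompleteSpace H] {v : J → H} {T : H →L[ℂ] H} (h : IsEnsemble v T) :
    T.IsPositive := by
  rw [ContinuousLinearMap.isPositive_iff_complex]
  intro x
  have hs := h.hasSum x x
  have e : ∀ j, ⟪x, v j⟫_ℂ * ⟪v j, x⟫_ℂ = ((‖⟪v j, x⟫_ℂ‖ ^ 2 : ℝ) : ℂ) := fun j => by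
    rw [← inner_conj_symm x (v j), ← Complex.normSq_eq_conj_mul_self, Complex.normSq_eq_norm_sq]
  simp only [e] at hs
  have hr := Complex.hasSum_re hs
  have hi := Complex.hasSum_im hs
  simp only [Complex.ofReal_re, Complex.ofReal_im] at hr hi
  have h0 : (⟪x, T x⟫_ℂ).im = 0 := hi.unique hasSum_zero
  have h1 : 0 ≤ (⟪x, T x⟫_ℂ).re := hr.nonneg fun j => by positivity
  have h2 : ⟪T x, x⟫_ℂ = ⟪x, T x⟫_ℂ := by
    rw [← inner_conj_symm, Complex.conj_eq_iff_im.2 h0]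
  rw [h2]
  exact ⟨Complex.ext (by simp) (by simp [h0]), h1⟩

/-- The rank-one operators `|vⱼ⟩⟨vⱼ|` have norm `‖vⱼ‖²`, so their sum converges absolutely in
operator norm. -/
lemma exists_isEnsemble [CompleteSpace H] {v : J → H} (hv : Summable fun j => ‖v j‖ ^ 2) :
    ∃ T : H →L[ℂ] H, IsEnsemble v T := by
  have hs : Summable fun j => InnerProductSpace.rankOne ℂ (v j) (v j) := by
    refine Summable.of_norm ?_
    simpa only [InnerProductSpace.norm_rankOne, ← sq] using hv
  refine ⟨∑' j, InnerProductSpace.rankOne ℂ (v j) (v j), hv, fun x y => ?_⟩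
  have h1 := (hs.hasSum.mapL (ContinuousLinearMap.apply ℂ H y)).mapL (innerSL ℂ x)
  refine h1.congr_fun fun j => ?_
  simp [InnerProductSpace.rankOne_apply, mul_comm]

/-- Parseval for `⟪S x, S y⟫`, with `S` moved across the inner product. Finiteness of the trace is
square-summability of the vectors `S bₖ`. -/
lemma isEnsemble_of_mul_self [CompleteSpace H] {S T : H →L[ℂ] H} (hS : IsSelfAdjoint S)
    (hT : S * S = T) (b : HilbertBasis K ℂ H) {c : ℂ}
    (hc : HasSum (fun k => ⟪b k, T (b k)⟫_ℂ) c) :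
    IsEnsemble (fun k => S (b k)) T where
  summable := by
    have := (Complex.hasSum_re hc).summable
    refine this.congr fun k => ?_
    have e : ⟪b k, S (S (b k))⟫_ℂ = ⟪S (b k), S (b k)⟫_ℂ := (hS.isSymmetric (b k) (S (b k))).symm
    rw [← hT, mul_apply_eq_comp, e, inner_self_eq_ofReal_norm_sq, Complex.ofReal_re]
  hasSum x y := by
    have := b.hasSum_inner_mul_inner (S x) (S y)
    have e : ⟪x, T y⟫_ℂ = ⟪S x, S y⟫_ℂ := by
      rw [← hT, mul_apply_eq_comp]
      exact (hS.isSymmetric x (S y)).symm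
    rw [e]
    refine this.congr_fun fun k => ?_
    congr 1
    · exact (hS.isSymmetric x (b k)).symm
    · exact hS.isSymmetric (b k) y

end Ensemble

section OperatorSqrt

variable {H : Type} [NormedAddCommGroup H] [InnerProductSpace ℂ H] [CompleteSpace H]

lemma isSelfAdjoint_operatorSqrt (T : H →L[ℂ] H) : IsSelfAdjoint (operatorSqrt T) :=
  IsSelfAdjoint.of_nonneg (CFC.sqrt_nonneg T)

lemma operatorSqrt_mul_self {T : H →L[ℂ] H} (hT : T.IsPositive) :
    operatorSqrt T * operatorSqrt T = T :=
  CFC.sqrt_mul_sqrt_self T ((ContinuousLinearMap.nonneg_iff_isPositive T).2 hT)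

end OperatorSqrt

/-! ### Density operators and their ensembles -/

section States

variable {α : Type} [Fintype α]

lemma DensityOperator.isSelfAdjoint_sqrt (ρ : DensityOperator α) : IsSelfAdjoint ρ.sqrt :=
  isSelfAdjoint_operatorSqrt ρ.op

lemma DensityOperator.sqrt_mul_sqrt (ρ : DensityOperator α) : ρ.sqrt * ρ.sqrt = ρ.op :=
  operatorSqrt_mul_self ρ.isPositive

/-- The vectors `ρ^{1/2} bᵢ` form an ensemble of `ρ`. -/
lemma DensityOperator.isEnsemble (ρ : DensityOperator α) :
    IsEnsemble (fun i => ρ.sqrt (traceBasis α i)) ρ.op :=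
  isEnsemble_of_mul_self ρ.isSelfAdjoint_sqrt ρ.sqrt_mul_sqrt _ ρ.hasSum_trace

lemma trace_eq_tsum {J : Type*} {v : J → HilbertSpace α} {T : HilbertSpace α →L[ℂ] HilbertSpace α}
    (h : IsEnsemble v T) (U : HilbertSpace α →L[ℂ] HilbertSpace α) :
    trace (T ∘L U) = ∑' j, ⟪v j, U (v j)⟫_ℂ :=
  (h.hasSum_trace (traceBasis α) U).tsum_eq

lemma DensityOperator.hasSum_norm_sq (ρ : DensityOperator α) {J : Type*} {v : J → HilbertSpace α}
    (h : IsEnsemble v ρ.op) : HasSum (fun j => ‖v j‖ ^ 2) 1 := by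
  have h1 := (h.hasSum_trace (traceBasis α) (ContinuousLinearMap.id ℂ _)).unique ρ.hasSum_trace
  simp only [ContinuousLinearMap.id_apply, inner_self_eq_ofReal_norm_sq] at h1
  have h2 := h.summable.hasSum
  rwa [show (∑' j, ‖v j‖ ^ 2) = 1 by exact_mod_cast h1] at h2

lemma exists_densityOperator {J : Type*} {v : J → HilbertSpace α}
    (hv : HasSum (fun j => ‖v j‖ ^ 2) 1) : ∃ ρ : DensityOperator α, IsEnsemble v ρ.op := by
  obtain ⟨T, hT⟩ := exists_isEnsemble hv.summable
  refine ⟨⟨T, hT.isPositive, ?_⟩, hT⟩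
  have h1 := hT.hasSum_trace (traceBasis α) (ContinuousLinearMap.id ℂ _)
  simp only [ContinuousLinearMap.id_apply, inner_self_eq_ofReal_norm_sq] at h1
  rwa [show (∑' j, ((‖v j‖ ^ 2 : ℝ) : ℂ)) = 1 by exact_mod_cast hv.tsum_eq] at h1

end States

/-! ### Weyl relations and continuity of displacement operators -/

section Displacement

open Filter Topology

variable {α : Type} [Fintype α]

/-- Half the symplectic product of two phase-space vectors. -/
noncomputable def weylPhase (r s : PhaseSpace α) : ℝ :=
  (∑ j, (r (j, 1) * s (j, 0) - s (j, 1) * r (j, 0))) / 2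

lemma weylPhase_smul_smul (a b : ℝ) (r s : PhaseSpace α) :
    weylPhase (a • r) (b • s) = a * b * weylPhase r s := by
  simp only [weylPhase, Pi.smul_apply, smul_eq_mul, mul_div_assoc', Finset.mul_sum]
  congr 1
  exact Finset.sum_congr rfl fun j _ => by ring

lemma weylPhase_self (r : PhaseSpace α) : weylPhase r r = 0 := by
  simp [weylPhase]

lemma weylPhase_sub_self (r s : PhaseSpace α) : weylPhase r (s - r) = weylPhase r s := by
  simp only [weylPhase, Pi.sub_apply]
  congr 1
  exact Finset.sum_congr rfl fun j _ => by ring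

/-- The cocycle identity behind the Weyl relations. -/
lemma phase_add (r s : PhaseSpace α) (x : α → ℝ) :
    phase r x + phase s (x - fun j => r (j, 0)) = weylPhase r s + phase (r + s) x := by
  simp only [phase, weylPhase, Pi.sub_apply, Pi.add_apply, mul_sub, add_mul, mul_add,
    Finset.sum_add_distrib, Finset.sum_sub_distrib]
  have : ∑ j, s (j, 1) * r (j, 0) = ∑ j, r (j, 0) * s (j, 1) :=
    Finset.sum_congr rfl fun j _ => mul_comm _ _
  ring

lemma displacement_displacement (r s : PhaseSpace α) (ψ : HilbertSpace α) :
    displacement r (displacement s ψ) =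
      Complex.exp (Complex.I * (weylPhase r s : ℂ)) • displacement (r + s) ψ := by
  apply Lp.ext
  have hq := (measurePreserving_sub_right (volume : Measure (α → ℝ))
    fun j => r (j, 0)).quasiMeasurePreserving
  filter_upwards [coeFn_displacement r (displacement s ψ), coeFn_displacement (r + s) ψ,
    hq.ae (coeFn_displacement s ψ),
    Lp.coeFn_smul (Complex.exp (Complex.I * (weylPhase r s : ℂ))) (displacement (r + s) ψ)]
    with x h1 h2 h3 h4
  rw [h1, h4, Pi.smul_apply, h2, h3, smul_eq_mul, ← mul_assoc, ← mul_assoc, ← Complex.exp_add,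
    ← Complex.exp_add, ← mul_add, ← mul_add, ← Complex.ofReal_add, ← Complex.ofReal_add, phase_add]
  congr 2
  ext j
  simp [sub_sub]

lemma norm_displacement (r : PhaseSpace α) (ψ : HilbertSpace α) : ‖displacement r ψ‖ = ‖ψ‖ :=
  ((phaseMul r).comp (translate r)).norm_map ψ

lemma inner_displacement_same (r : PhaseSpace α) (ψ φ : HilbertSpace α) :
    ⟪displacement r ψ, displacement r φ⟫_ℂ = ⟪ψ, φ⟫_ℂ :=
  ((phaseMul r).comp (translate r)).inner_map_map ψ φ

lemma displacement_zero (ψ : HilbertSpace α) : displacement (0 : PhaseSpace α) ψ = ψ := by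
  apply Lp.ext
  filter_upwards [coeFn_displacement (0 : PhaseSpace α) ψ] with x h
  rw [h]
  simp only [phase, Pi.zero_apply, zero_mul, mul_zero, Finset.sum_const_zero, zero_div, sub_zero,
    Complex.ofReal_zero, Complex.exp_zero, one_mul]
  congr 1
  ext j
  simp

/-- Unitarity and the Weyl relations leave a single displacement. The phase does not depend on the
vectors, so it survives summation over an ensemble and leaves a value of the characteristic
function. -/
lemma inner_displacement (r s : PhaseSpace α) (ψ φ : HilbertSpace α) :
    ⟪displacement r ψ, displacement s φ⟫_ℂ =
      Complex.exp (-(Complex.I * (weylPhase r s : ℂ))) * ⟪ψ, displacement (s - r) φ⟫_ℂ := by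
  have h := displacement_displacement r (s - r) φ
  rw [add_sub_cancel, weylPhase_sub_self] at h
  rw [← inner_displacement_same r ψ, h, inner_smul_right, ← mul_assoc, ← Complex.exp_add,
    neg_add_cancel, Complex.exp_zero, one_mul]

lemma continuous_phase (x : α → ℝ) : Continuous fun r : PhaseSpace α => phase r x := by
  unfold phase
  fun_prop

lemma continuous_inner_phaseMul (χ ψ : HilbertSpace α) :
    Continuous fun r => ⟪χ, phaseMul r ψ⟫_ℂ := by
  have h : ∀ r, ⟪χ, phaseMul r ψ⟫_ℂ = ∫ x, ⟪χ x, phaseFactor r x * ψ x⟫_ℂ := fun r => by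
    rw [L2.inner_def]
    refine integral_congr_ae ?_
    filter_upwards [(memLp_phaseFactor_mul r ψ).coeFn_toLp] with x hx
    exact congrArg (fun z => ⟪χ x, z⟫_ℂ) hx
  simp only [h]
  refine continuous_of_dominated (bound := fun x => ‖χ x‖ * ‖ψ x‖) (fun r => ?_) (fun r => ?_) ?_ ?_
  · exact (Lp.aestronglyMeasurable χ).inner
      ((continuous_phaseFactor r).aestronglyMeasurable.mul (Lp.aestronglyMeasurable ψ))
  · refine Eventually.of_forall fun x => (norm_inner_le_norm _ _).trans ?_
    rw [norm_mul, norm_phaseFactor, one_mul]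
  · exact (Lp.memLp χ).norm.integrable_mul (Lp.memLp ψ).norm
  · refine Eventually.of_forall fun x => ?_
    have := continuous_phase x
    unfold phaseFactor
    fun_prop

/-- Weak continuity upgrades to strong continuity because the operators are isometries: `‖aᵣ - a‖²`
is determined by the fixed norms and one inner product. -/
lemma continuous_phaseMul (ψ : HilbertSpace α) :
    Continuous fun r : PhaseSpace α => phaseMul r ψ := by
  rw [continuous_iff_continuousAt]
  intro r₀
  rw [ContinuousAt, tendsto_iff_norm_sub_tendsto_zero]
  have h1 : Tendsto (fun r => ‖ψ‖ ^ 2 - 2 * (⟪phaseMul r₀ ψ, phaseMul r ψ⟫_ℂ).re + ‖ψ‖ ^ 2) (𝓝 r₀)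
      (𝓝 (‖ψ‖ ^ 2 - 2 * (⟪phaseMul r₀ ψ, phaseMul r₀ ψ⟫_ℂ).re + ‖ψ‖ ^ 2)) :=
    ((tendsto_const_nhds.sub (((Complex.continuous_re.comp
      (continuous_inner_phaseMul _ ψ)).tendsto r₀).const_mul 2)).add tendsto_const_nhds)
  rw [(phaseMul r₀).inner_map_map, inner_self_eq_ofReal_norm_sq, Complex.ofReal_re] at h1
  have h2 : ∀ r, ‖ψ‖ ^ 2 - 2 * (⟪phaseMul r₀ ψ, phaseMul r ψ⟫_ℂ).re + ‖ψ‖ ^ 2 =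
      ‖phaseMul r ψ - phaseMul r₀ ψ‖ ^ 2 := fun r => by
    rw [norm_sub_rev, @norm_sub_sq ℂ, (phaseMul r₀).norm_map, (phaseMul r).norm_map]
    rfl
  simp only [h2] at h1
  have h3 := h1.sqrt
  simp only [Real.sqrt_sq (norm_nonneg _)] at h3
  convert h3 using 2
  rw [show ‖ψ‖ ^ 2 - 2 * ‖ψ‖ ^ 2 + ‖ψ‖ ^ 2 = 0 by ring, Real.sqrt_zero]

lemma continuous_translate (ψ : HilbertSpace α) :
    Continuous fun r : PhaseSpace α => translate r ψ := by
  let g : PhaseSpace α → C(α → ℝ, α → ℝ) := fun r => ⟨fun x => x - fun j => r (j, 0), by fun_prop⟩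
  have hg : Continuous g := by
    refine ContinuousMap.continuous_of_continuous_uncurry _ ?_
    simp only [g, Function.uncurry_def, ContinuousMap.coe_mk]
    fun_prop
  exact continuous_const.compMeasurePreservingLp (f := fun _ => ψ) hg
    (fun r => measurePreserving_sub_right volume fun j => r (j, 0)) (by simp)

lemma continuous_displacement (ψ : HilbertSpace α) :
    Continuous fun r : PhaseSpace α => displacement r ψ := by
  rw [continuous_iff_continuousAt]
  intro r₀
  rw [ContinuousAt, tendsto_iff_norm_sub_tendsto_zero]
  have h1 := tendsto_iff_norm_sub_tendsto_zero.1 ((continuous_translate ψ).tendsto r₀)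
  have h2 := tendsto_iff_norm_sub_tendsto_zero.1 ((continuous_phaseMul (translate r₀ ψ)).tendsto r₀)
  refine squeeze_zero (fun _ => norm_nonneg _) (fun r => ?_) (by simpa using h1.add h2)
  have e : displacement r ψ - displacement r₀ ψ = phaseMul r (translate r ψ - translate r₀ ψ) +
      (phaseMul r (translate r₀ ψ) - phaseMul r₀ (translate r₀ ψ)) := by
    rw [map_sub]
    simp [displacement]
  rw [e]
  refine (norm_add_le _ _).trans ?_
  rw [(phaseMul r).norm_map]

lemma characteristicFunction_eq_tsum {J : Type*} {v : J → HilbertSpace α} {ρ : DensityOperator α}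
    (h : IsEnsemble v ρ.op) (r : PhaseSpace α) :
    characteristicFunction ρ r = ∑' j, ⟪v j, displacement r (v j)⟫_ℂ :=
  trace_eq_tsum h _

lemma norm_inner_displacement_le (r : PhaseSpace α) (ψ : HilbertSpace α) :
    ‖⟪ψ, displacement r ψ⟫_ℂ‖ ≤ ‖ψ‖ ^ 2 := by
  refine (norm_inner_le_norm _ _).trans ?_
  rw [norm_displacement, sq]

/-- The series is dominated uniformly in `r` by `∑ ‖vᵢ‖²`. Continuity is what makes Fourier
inversion valid at every point. -/
lemma continuous_characteristicFunction (ρ : DensityOperator α) :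
    Continuous (characteristicFunction ρ) := by
  have h : characteristicFunction ρ = fun r => _ :=
    funext fun r => characteristicFunction_eq_tsum ρ.isEnsemble r
  rw [h]
  exact continuous_tsum (fun i => continuous_const.inner (continuous_displacement _))
    ρ.isEnsemble.summable fun i r => norm_inner_displacement_le r _

end Displacement

/-! ### Square roots of positive definite matrices -/

section MatrixSqrt

variable {n : Type*} [Fintype n] [DecidableEq n] {γ : Matrix n n ℝ}

lemma sqrt_mul_sqrt_of_posDef (hγ : γ.PosDef) : CFC.sqrt γ * CFC.sqrt γ = γ :=
  CFC.sqrt_mul_sqrt_self γ (nonneg_iff_posSemidef.2 hγ.posSemidef)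

lemma transpose_sqrt (γ : Matrix n n ℝ) : (CFC.sqrt γ)ᵀ = CFC.sqrt γ := by
  have h : (CFC.sqrt γ).PosSemidef := nonneg_iff_posSemidef.1 (CFC.sqrt_nonneg γ)
  simpa [Matrix.IsHermitian] using h.1

lemma det_sqrt_of_posDef (hγ : γ.PosDef) : (CFC.sqrt γ).det = Real.sqrt γ.det := by
  have h : (CFC.sqrt γ).PosSemidef := nonneg_iff_posSemidef.1 (CFC.sqrt_nonneg γ)
  have h1 := congrArg det (sqrt_mul_sqrt_of_posDef hγ)
  rw [det_mul] at h1
  rw [← h1, Real.sqrt_mul_self h.det_nonneg]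

lemma isUnit_det_sqrt (hγ : γ.PosDef) : IsUnit (CFC.sqrt γ).det := by
  rw [det_sqrt_of_posDef hγ]
  exact (Real.sqrt_ne_zero'.2 hγ.det_pos).isUnit

lemma dotProduct_mulVec_eq_sqrt (hγ : γ.PosDef) (x y : n → ℝ) :
    x ⬝ᵥ (γ *ᵥ y) = (CFC.sqrt γ *ᵥ x) ⬝ᵥ (CFC.sqrt γ *ᵥ y) := by
  conv_lhs => rw [← sqrt_mul_sqrt_of_posDef hγ, ← mulVec_mulVec, dotProduct_mulVec,
    ← mulVec_transpose, transpose_sqrt]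

lemma sqrt_mulVec_dotProduct_inv_mulVec (hγ : γ.PosDef) (x : n → ℝ) :
    (CFC.sqrt γ *ᵥ x) ⬝ᵥ (γ⁻¹ *ᵥ (CFC.sqrt γ *ᵥ x)) = x ⬝ᵥ x := by
  have hu := isUnit_det_sqrt hγ
  have h : γ⁻¹ *ᵥ (CFC.sqrt γ *ᵥ x) = (CFC.sqrt γ)⁻¹ *ᵥ x := by
    conv_lhs => rw [← sqrt_mul_sqrt_of_posDef hγ]
    rw [sqrt_mul_sqrt_of_posDef hγ, mulVec_mulVec]
    conv_lhs => rw [← sqrt_mul_sqrt_of_posDef hγ, Matrix.mul_inv_rev]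
    rw [sqrt_mul_sqrt_of_posDef hγ, mul_assoc, nonsing_inv_mul _ hu, mul_one]
  rw [h, dotProduct_comm, dotProduct_mulVec, ← mulVec_transpose, transpose_sqrt, mulVec_mulVec,
    mul_nonsing_inv _ hu, one_mulVec]

end MatrixSqrt

/-! ### Fourier transforms of Gaussian densities -/

section GaussianIntegral

variable {n : Type*} [Fintype n]

lemma integral_comp_mulVec [DecidableEq n] {M : Matrix n n ℝ} (hM : M.det ≠ 0)
    (f : (n → ℝ) → ℂ) : ∫ x, f (M *ᵥ x) = ((|M.det|⁻¹ : ℝ) : ℂ) * ∫ x, f x := by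
  have e : MeasurableEmbedding (toLin' M) :=
    (toLin' M).continuous_of_finiteDimensional.measurableEmbedding
      (mulVec_injective_iff_isUnit.2 ((isUnit_iff_isUnit_det M).2 hM.isUnit))
  have h1 := e.integral_map (μ := volume) f
  rw [Real.map_matrix_volume_pi_eq_smul_volume_pi hM, integral_smul_measure] at h1
  simp only [toLin'_apply] at h1
  rw [← h1, ENNReal.toReal_ofReal (abs_nonneg _), abs_inv]
  simp

/-- The substitution `s = γ^{1/2} x + d` reduces to the standard Gaussian, whose Fourier transform
is known. -/
lemma integral_gaussian_cexp [DecidableEq n] {γ : Matrix n n ℝ} (hγ : γ.PosDef) (d w : n → ℝ) :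
    ∫ s : n → ℝ, ((Real.exp (-((s - d) ⬝ᵥ (γ⁻¹ *ᵥ (s - d)))) : ℝ) : ℂ) *
        Complex.exp (Complex.I * ((w ⬝ᵥ s : ℝ) : ℂ)) =
      (Real.pi : ℂ) ^ (Fintype.card n / 2 : ℂ) * ((Real.sqrt γ.det : ℝ) : ℂ) *
        Complex.exp (Complex.I * ((w ⬝ᵥ d : ℝ) : ℂ) - ((w ⬝ᵥ (γ *ᵥ w) / 4 : ℝ) : ℂ)) := by
  set B := CFC.sqrt γ with hB
  have hd : B.det = Real.sqrt γ.det := det_sqrt_of_posDef hγ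
  have hpos : 0 < Real.sqrt γ.det := Real.sqrt_pos.2 hγ.det_pos
  rw [← integral_add_right_eq_self _ d]
  simp only [add_sub_cancel_right]
  have h1 := integral_comp_mulVec (M := B) (by rw [hd]; exact hpos.ne') (fun s =>
    ((Real.exp (-(s ⬝ᵥ (γ⁻¹ *ᵥ s))) : ℝ) : ℂ) *
        Complex.exp (Complex.I * ((w ⬝ᵥ (s + d) : ℝ) : ℂ)))
  rw [hd, abs_of_pos hpos] at h1
  have h2 : ∀ x : n → ℝ, ((Real.exp (-((B *ᵥ x) ⬝ᵥ (γ⁻¹ *ᵥ (B *ᵥ x)))) : ℝ) : ℂ) *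
        Complex.exp (Complex.I * ((w ⬝ᵥ (B *ᵥ x + d) : ℝ) : ℂ)) =
      Complex.exp (Complex.I * ((w ⬝ᵥ d : ℝ) : ℂ)) *
      Complex.exp (-1 * ∑ i, (x i : ℂ) ^ 2 + ∑ i, (Complex.I * ((B *ᵥ w) i : ℂ)) * x i) := by
    intro x
    have e : w ⬝ᵥ (B *ᵥ x) = ∑ i, (B *ᵥ w) i * x i := by
      rw [dotProduct_mulVec, ← mulVec_transpose, transpose_sqrt]
      rfl
    rw [hB, sqrt_mulVec_dotProduct_inv_mulVec hγ, ← hB, dotProduct_add, e, Complex.ofReal_exp,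
      ← Complex.exp_add, ← Complex.exp_add]
    congr 1
    simp only [dotProduct, ← sq]
    push_cast
    simp only [mul_assoc, ← Finset.mul_sum]
    ring
  simp only [h2] at h1
  rw [integral_const_mul, GaussianFourier.integral_cexp_neg_mul_sum_add (by simp)] at h1
  have h3 : ∀ z : ℂ, ((Real.sqrt γ.det : ℝ) : ℂ) * (((Real.sqrt γ.det)⁻¹ : ℝ) * z) = z := fun z => by
    rw [← mul_assoc, ← Complex.ofReal_mul, mul_inv_cancel₀ hpos.ne', Complex.ofReal_one, one_mul]
  rw [← h3 (∫ s, _), ← h1, div_one, sub_eq_add_neg, Complex.exp_add]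
  have h4 : (∑ i, (Complex.I * ((B *ᵥ w) i : ℂ)) ^ 2) / (4 * 1) =
      -((w ⬝ᵥ (γ *ᵥ w) / 4 : ℝ) : ℂ) := by
    rw [dotProduct_mulVec_eq_sqrt hγ, ← hB]
    simp only [dotProduct, mul_pow, Complex.I_sq, ← sq]
    push_cast
    rw [← Finset.mul_sum]
    ring
  rw [h4]
  ring

/-- Fourier inversion on `ℝⁿ`, with the convention `Φ(y) = ∫ χ(r) exp (i r · y) dr`. -/
lemma fourier_inversion_pi {χ : (n → ℝ) → ℂ} (hc : Continuous χ) (hi : Integrable χ)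
    (hΦ : Integrable fun y : n → ℝ =>
      ∫ r : n → ℝ, χ r * Complex.exp (Complex.I * ((r ⬝ᵥ y : ℝ) : ℂ))) (r : n → ℝ) :
    ∫ y : n → ℝ, (∫ r : n → ℝ, χ r * Complex.exp (Complex.I * ((r ⬝ᵥ y : ℝ) : ℂ))) *
      Complex.exp (-(Complex.I * ((r ⬝ᵥ y : ℝ) : ℂ))) =
    (((2 * Real.pi) ^ Fintype.card n : ℝ) : ℂ) * χ r := by
  set Φ : (n → ℝ) → ℂ := fun y =>
    ∫ r : n → ℝ, χ r * Complex.exp (Complex.I * ((r ⬝ᵥ y : ℝ) : ℂ)) with hΦdef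
  -- Inversion is stated on inner product spaces, so `χ` is transported along the volume-preserving
  -- identification with Euclidean space.
  let f : EuclideanSpace ℝ n → ℂ := fun v => χ v.ofLp
  have mp := PiLp.volume_preserving_ofLp n
  have me : MeasurableEmbedding (WithLp.ofLp : EuclideanSpace ℝ n → n → ℝ) :=
    (MeasurableEquiv.toLp 2 (n → ℝ)).symm.measurableEmbedding
  have hfi : Integrable f := (mp.integrable_comp_emb me).2 hi
  have hfc : Continuous f := hc.comp (PiLp.continuous_ofLp 2 _)
  have hin : ∀ v w : EuclideanSpace ℝ n, ⟪v, w⟫_ℝ = v.ofLp ⬝ᵥ w.ofLp := fun v w => by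
    rw [EuclideanSpace.inner_eq_star_dotProduct, dotProduct_comm]
    simp
  -- The rescaling by `-2π` converts between the kernels `exp (-2πi v·w)` and `exp (i r·y)`; its
  -- Jacobian is the constant in the conclusion.
  have hF : ∀ w : EuclideanSpace ℝ n, FourierTransform.fourier f w =
      Φ ((-(2 * Real.pi)) • w.ofLp) := fun w => by
    rw [Real.fourier_eq', hΦdef]
    refine Eq.trans ?_ (mp.integral_comp me _)
    refine integral_congr_ae (Filter.Eventually.of_forall fun v => ?_)
    simp only [hin, smul_eq_mul, dotProduct_smul, f]
    rw [mul_comm]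
    congr 2
    push_cast
    ring
  have hπ : (-(2 * Real.pi)) ≠ 0 := by simp [Real.pi_ne_zero]
  have hFi : Integrable (FourierTransform.fourier f) := by
    have : FourierTransform.fourier f = (fun y => Φ ((-(2 * Real.pi)) • y)) ∘ WithLp.ofLp :=
      funext hF
    rw [this]
    exact (mp.integrable_comp_emb me).2 (hΦ.comp_smul hπ)
  have h1 := congrFun (hfc.fourierInv_fourier_eq hfi hFi) (WithLp.toLp 2 r)
  rw [Real.fourierInv_eq'] at h1
  have h2 := integral_congr_ae (ae_of_all volume
    fun v : EuclideanSpace ℝ n => show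
      Complex.exp (((2 * Real.pi * ⟪v, WithLp.toLp 2 r⟫_ℝ : ℝ) : ℂ) * Complex.I) •
        FourierTransform.fourier f v = (fun y : n → ℝ => (fun y => Φ y *
          Complex.exp (-(Complex.I * ((r ⬝ᵥ y : ℝ) : ℂ)))) ((-(2 * Real.pi)) • y)) v.ofLp by
      simp only [hF, hin, smul_eq_mul, dotProduct_smul]
      rw [mul_comm, dotProduct_comm]
      congr 2
      push_cast
      ring)
  rw [h2] at h1
  replace h1 := (mp.integral_comp me (fun y : n → ℝ => (fun y => Φ y *
    Complex.exp (-(Complex.I * ((r ⬝ᵥ y : ℝ) : ℂ)))) ((-(2 * Real.pi)) • y))).symm.trans h1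
  replace h1 := (Measure.integral_comp_smul volume (fun y : n → ℝ => Φ y *
    Complex.exp (-(Complex.I * ((r ⬝ᵥ y : ℝ) : ℂ)))) (-(2 * Real.pi))).symm.trans h1
  have h3 : |((-(2 * Real.pi)) ^ Module.finrank ℝ (n → ℝ))⁻¹| =
      ((2 * Real.pi) ^ Fintype.card n)⁻¹ := by
    rw [Module.finrank_fintype_fun_eq_card, abs_inv, abs_pow, abs_neg,
      abs_of_pos Real.two_pi_pos]
  have hp : (2 * Real.pi) ^ Fintype.card n ≠ 0 := (pow_pos Real.two_pi_pos _).ne'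
  rw [h3] at h1
  change _ = χ r at h1
  rw [← h1, Complex.real_smul, ← mul_assoc, ← Complex.ofReal_mul, mul_inv_cancel₀ hp,
    Complex.ofReal_one, one_mul]

end GaussianIntegral

/-! ### The characteristic function of a Gaussian state -/

section GaussianChar

variable {α : Type} [Fintype α] [DecidableEq α]

/-- The characteristic function of `ρ` is that of the Gaussian state with first moments `d` and
covariance matrix `γ`. -/
def HasGaussianChar (ρ : DensityOperator α) (d : PhaseSpace α)
    (γ : Matrix (α × Fin 2) (α × Fin 2) ℝ) : Prop :=
  ∀ w : PhaseSpace α, characteristicFunction ρ (-(Omega α *ᵥ w)) =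
    Complex.exp (Complex.I * ((w ⬝ᵥ d : ℝ) : ℂ) - ((w ⬝ᵥ (γ *ᵥ w) / 4 : ℝ) : ℂ))

lemma transpose_Omega {α : Type} [DecidableEq α] : (Omega α)ᵀ = -Omega α := by
  ext ⟨i, a⟩ ⟨j, b⟩
  fin_cases a <;> fin_cases b <;> simp [Omega, Matrix.one_apply, eq_comm]

lemma Omega_mul_Omega : Omega α * Omega α = -1 := by
  rw [Omega, ← mul_kronecker_mul, one_mul]
  have : (!![0, 1; -1, 0] : Matrix (Fin 2) (Fin 2) ℝ) * !![0, 1; -1, 0] = -1 := by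
    ext i j
    fin_cases i <;> fin_cases j <;> simp [Matrix.mul_apply]
  rw [this]
  ext ⟨i, a⟩ ⟨j, b⟩
  simp [Matrix.one_apply, Prod.ext_iff, ← ite_and, and_comm]

lemma det_neg_Omega : (-Omega α).det = 1 := by
  rw [← neg_one_smul ℝ, Matrix.det_smul, Omega, det_kronecker]
  simp [det_fin_two, pow_mul']

lemma Omega_mulVec_Omega_mulVec (w : PhaseSpace α) : Omega α *ᵥ (Omega α *ᵥ w) = -w := by
  rw [mulVec_mulVec, Omega_mul_Omega, neg_mulVec, one_mulVec]

lemma dotProduct_Omega_mulVec (w y : PhaseSpace α) :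
    (Omega α *ᵥ w) ⬝ᵥ y = -(w ⬝ᵥ (Omega α *ᵥ y)) := by
  rw [dotProduct_comm, dotProduct_mulVec, ← mulVec_transpose, transpose_Omega, neg_mulVec,
    neg_dotProduct, dotProduct_comm]

/-- The Bochner integral of a non-integrable function is `0` by convention, so a nonzero integral
certifies integrability. -/
lemma integral_ne_zero_integrable {X : Type*} [MeasurableSpace X] {μ : Measure X} {f : X → ℂ}
    (h : ∫ x, f x ∂μ ≠ 0) : Integrable f μ :=
  not_imp_comm.1 integral_undef h

/-- The Wigner function is, up to a constant and a rotation by `Ω`, the Fourier transform of `χ`;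
inverting it reduces to the Fourier transform of a Gaussian. -/
lemma exists_hasGaussianChar_of_wignerFunction {ρ : DensityOperator α} {d : PhaseSpace α}
    {γ : Matrix (α × Fin 2) (α × Fin 2) ℝ} (hγ : γ.PosDef)
    (h : ∀ s : PhaseSpace α, wignerFunction ρ s =
      ((Real.exp (-((s - d) ⬝ᵥ (γ⁻¹ *ᵥ (s - d)))) /
        (Real.pi ^ Fintype.card α * Real.sqrt γ.det) : ℝ) : ℂ)) :
    HasGaussianChar ρ d γ := by
  have hdet : 0 < Real.sqrt γ.det := Real.sqrt_pos.2 hγ.det_pos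
  have hπ : (0 : ℝ) < Real.pi ^ Fintype.card α := pow_pos Real.pi_pos _
  have hcard : (Fintype.card (α × Fin 2) / 2 : ℂ) = Fintype.card α := by
    simp [Fintype.card_prod]
  have h2π : (((2 * Real.pi) ^ (2 * Fintype.card α) : ℝ) : ℂ) ≠ 0 := by
    exact_mod_cast (pow_pos Real.two_pi_pos _).ne'
  set χ := characteristicFunction ρ with hχ
  set W : PhaseSpace α → ℂ := wignerFunction ρ with hW
  have hgauss : ∀ w : PhaseSpace α, ∫ s, W s * Complex.exp (Complex.I * ((w ⬝ᵥ s : ℝ) : ℂ)) =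
      Complex.exp (Complex.I * ((w ⬝ᵥ d : ℝ) : ℂ) - ((w ⬝ᵥ (γ *ᵥ w) / 4 : ℝ) : ℂ)) := fun w => by
    have e : ∀ s : PhaseSpace α, W s * Complex.exp (Complex.I * ((w ⬝ᵥ s : ℝ) : ℂ)) =
        (((Real.pi ^ Fintype.card α * Real.sqrt γ.det)⁻¹ : ℝ) : ℂ) *
        (((Real.exp (-((s - d) ⬝ᵥ (γ⁻¹ *ᵥ (s - d)))) : ℝ) : ℂ) *
        Complex.exp (Complex.I * ((w ⬝ᵥ s : ℝ) : ℂ))) := fun s => by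
      rw [h s, div_eq_inv_mul, Complex.ofReal_mul, mul_assoc]
    simp only [e]
    rw [integral_const_mul, integral_gaussian_cexp hγ, hcard, Complex.cpow_natCast, ← mul_assoc,
      ← Complex.ofReal_pow, ← Complex.ofReal_mul, ← Complex.ofReal_mul,
      inv_mul_cancel₀ (mul_pos hπ hdet).ne', Complex.ofReal_one, one_mul]
  have hWi : Integrable W := by
    refine integral_ne_zero_integrable ?_
    have := hgauss 0
    simp only [zero_dotProduct, Complex.ofReal_zero, mul_zero, Complex.exp_zero, mul_one] at this
    rw [this]
    exact Complex.exp_ne_zero _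
  -- Integrability of `χ` is not assumed. Were it to fail, the integral defining `W 0` would be the
  -- default `0`, contradicting positivity of the Gaussian density.
  have hχi : Integrable χ := by
    refine integral_ne_zero_integrable fun h0 => ?_
    have h1 := h 0
    have h2 : W 0 = 0 := by
      rw [hW, wignerFunction]
      simp only [mulVec_zero, dotProduct_zero, Complex.ofReal_zero, mul_zero, Complex.exp_zero,
        mul_one]
      rw [← hχ, h0, mul_zero]
    rw [h2, eq_comm] at h1
    have : Real.exp (-((0 - d) ⬝ᵥ (γ⁻¹ *ᵥ (0 - d)))) /
        (Real.pi ^ Fintype.card α * Real.sqrt γ.det) ≠ 0 := by positivity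
    exact this (by exact_mod_cast h1)
  have hΦ : ∀ y : PhaseSpace α, ∫ r, χ r * Complex.exp (Complex.I * ((r ⬝ᵥ y : ℝ) : ℂ)) =
      (((2 * Real.pi) ^ (2 * Fintype.card α) : ℝ) : ℂ) * W (-Omega α *ᵥ y) := fun y => by
    rw [hW, wignerFunction, ← mul_assoc, mul_inv_cancel₀ h2π, one_mul]
    simp only [neg_mulVec, mulVec_neg, Omega_mulVec_Omega_mulVec, neg_neg]
    rfl
  have hdetO : (-Omega α).det ≠ 0 := by rw [det_neg_Omega]; exact one_ne_zero
  have hWi' : Integrable fun y : PhaseSpace α => W (-Omega α *ᵥ y) := by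
    refine integral_ne_zero_integrable ?_
    rw [integral_comp_mulVec hdetO W, det_neg_Omega]
    have := hgauss 0
    simp only [zero_dotProduct, Complex.ofReal_zero, mul_zero, Complex.exp_zero, mul_one] at this
    rw [this]
    simp
  intro w
  have hinv := fourier_inversion_pi (continuous_characteristicFunction ρ) hχi
    (by simp only [← hχ, hΦ]; exact hWi'.const_mul _) (-(Omega α *ᵥ w))
  rw [← hχ] at hinv
  simp only [hΦ] at hinv
  have e : ∀ y : PhaseSpace α, (((2 * Real.pi) ^ (2 * Fintype.card α) : ℝ) : ℂ) *
        W (-Omega α *ᵥ y) * Complex.exp (-(Complex.I * ((-(Omega α *ᵥ w) ⬝ᵥ y : ℝ) : ℂ))) =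
      (((2 * Real.pi) ^ (2 * Fintype.card α) : ℝ) : ℂ) *
        (fun z => W z * Complex.exp (Complex.I * ((w ⬝ᵥ z : ℝ) : ℂ))) (-Omega α *ᵥ y) := fun y => by
    simp only [neg_dotProduct, dotProduct_Omega_mulVec, neg_mulVec, dotProduct_neg, neg_neg,
      Complex.ofReal_neg, mul_neg, mul_assoc]
  simp only [e] at hinv
  rw [integral_const_mul, integral_comp_mulVec hdetO (fun z => W z *
    Complex.exp (Complex.I * ((w ⬝ᵥ z : ℝ) : ℂ))), hgauss, det_neg_Omega, Fintype.card_prod,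
    Fintype.card_fin, mul_comm (Fintype.card α) 2] at hinv
  simp only [abs_one, inv_one, Complex.ofReal_one, one_mul] at hinv
  exact (mul_left_cancel₀ h2π hinv).symm

end GaussianChar

/-! ### Differentiability from convergence of inner products -/

section DifferenceQuotients

open Filter Topology

variable {E : Type*} [NormedAddCommGroup E] [InnerProductSpace ℂ E]

/-- The filter of pairs of nonzero reals tending to zero. -/
abbrev puncturedPairs : Filter (ℝ × ℝ) := 𝓝[≠] (0 : ℝ) ×ˢ 𝓝[≠] (0 : ℝ)

/-- Expanding `‖q t - q s‖²` gives the limit `L - 2L + L = 0` (in real parts), so `q` is Cauchy.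
This needs the joint limit with `t` and `s` independent, not just the diagonal. -/
lemma exists_tendsto_of_inner_tendsto [CompleteSpace E] {q : ℝ → E} {L : ℂ}
    (h : Tendsto (fun p : ℝ × ℝ => ⟪q p.1, q p.2⟫_ℂ) puncturedPairs (𝓝 L)) :
    ∃ Z, Tendsto q (𝓝[≠] 0) (𝓝 Z) := by
  refine cauchy_map_iff_exists_tendsto.1 (cauchy_map_iff.2 ⟨inferInstance, ?_⟩)
  rw [tendsto_uniformity_iff_dist_tendsto_zero]
  have h1 := h.comp (tendsto_fst (f := 𝓝[≠] (0 : ℝ)) (g := 𝓝[≠] (0 : ℝ)) |>.prodMk tendsto_fst)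
  have h2 := h.comp (tendsto_snd (f := 𝓝[≠] (0 : ℝ)) (g := 𝓝[≠] (0 : ℝ)) |>.prodMk tendsto_snd)
  have h3 := ((Complex.continuous_re.tendsto _).comp h1).sub
    (((Complex.continuous_re.tendsto _).comp h).const_mul 2) |>.add
    ((Complex.continuous_re.tendsto _).comp h2)
  have h4 := h3.sqrt
  rw [show L.re - 2 * L.re + L.re = 0 by ring, Real.sqrt_zero] at h4
  refine h4.congr fun p => ?_
  rw [dist_eq_norm, ← Real.sqrt_sq (norm_nonneg (q p.1 - q p.2)), @norm_sub_sq ℂ]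
  simp only [Function.comp, inner_self_eq_ofReal_norm_sq, Complex.ofReal_re]
  rfl

lemma tendsto_div_of_hasDerivAt {h : ℝ → ℂ} {z : ℂ} (hd : HasDerivAt h z 0) (h0 : h 0 = 1) :
    Tendsto (fun t : ℝ => ((t⁻¹ : ℝ) : ℂ) * (h t - 1)) (𝓝[≠] 0) (𝓝 z) := by
  have := hasDerivAt_iff_tendsto_slope_zero.1 hd
  simpa only [zero_add, h0, Complex.real_smul] using this

lemma hasDerivAt_cexp_quadratic (z w : ℂ) :
    HasDerivAt (fun t : ℝ => Complex.exp (z * t - w * t ^ 2)) z 0 := by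
  have h1 : HasDerivAt (fun t : ℂ => Complex.exp (z * t - w * t ^ 2))
      (Complex.exp (z * ((0 : ℝ) : ℂ) - w * ((0 : ℝ) : ℂ) ^ 2) *
        (z * 1 - w * (((2 : ℕ) : ℂ) * ((0 : ℝ) : ℂ) ^ (2 - 1)))) ((0 : ℝ) : ℂ) :=
    (((hasDerivAt_id _).const_mul z).sub ((hasDerivAt_pow 2 _).const_mul w)).cexp
  simpa using h1.comp_ofReal

/-- Inner products of difference quotients of two curves whose inner products are Gaussian. -/
lemma tendsto_inner_quotients {F G : ℝ → E} {V : E} {z₁ z₂ w₁ w₂ κ : ℂ} (hV : ⟪V, V⟫_ℂ = 1)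
    (hF : ∀ t : ℝ, ⟪F t, V⟫_ℂ = Complex.exp (z₁ * t - w₁ * t ^ 2))
    (hG : ∀ s : ℝ, ⟪V, G s⟫_ℂ = Complex.exp (z₂ * s - w₂ * s ^ 2))
    (hFG : ∀ t s : ℝ, ⟪F t, G s⟫_ℂ = ⟪F t, V⟫_ℂ * ⟪V, G s⟫_ℂ * Complex.exp (κ * ((t * s : ℝ) : ℂ))) :
    Tendsto (fun p : ℝ × ℝ => ⟪((p.1⁻¹ : ℝ) : ℂ) • (F p.1 - V), ((p.2⁻¹ : ℝ) : ℂ) • (G p.2 - V)⟫_ℂ)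
      puncturedPairs (𝓝 (z₁ * z₂ + κ)) := by
  have d1 := (tendsto_div_of_hasDerivAt (hasDerivAt_cexp_quadratic z₁ w₁) (by simp)).comp
    (tendsto_fst (f := 𝓝[≠] (0 : ℝ)) (g := 𝓝[≠] (0 : ℝ)))
  have d2 := (tendsto_div_of_hasDerivAt (hasDerivAt_cexp_quadratic z₂ w₂) (by simp)).comp
    (tendsto_snd (f := 𝓝[≠] (0 : ℝ)) (g := 𝓝[≠] (0 : ℝ)))
  have c1 := ((hasDerivAt_cexp_quadratic z₁ w₁).continuousAt.tendsto.mono_left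
    (nhdsWithin_le_nhds (s := {0}ᶜ))).comp (tendsto_fst (f := 𝓝[≠] (0 : ℝ)) (g := 𝓝[≠] (0 : ℝ)))
  have c2 := ((hasDerivAt_cexp_quadratic z₂ w₂).continuousAt.tendsto.mono_left
    (nhdsWithin_le_nhds (s := {0}ᶜ))).comp (tendsto_snd (f := 𝓝[≠] (0 : ℝ)) (g := 𝓝[≠] (0 : ℝ)))
  have hm : Tendsto (fun p : ℝ × ℝ => p.1 * p.2) puncturedPairs (𝓝[≠] 0) := by
    refine tendsto_nhdsWithin_of_tendsto_nhds_of_eventually_within _ ?_ ?_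
    · have := (tendsto_fst (f := 𝓝[≠] (0 : ℝ)) (g := 𝓝[≠] (0 : ℝ))).mono_right nhdsWithin_le_nhds
      have h2 := (tendsto_snd (f := 𝓝[≠] (0 : ℝ)) (g := 𝓝[≠] (0 : ℝ))).mono_right nhdsWithin_le_nhds
      simpa using this.mul h2
    · have h1 : ∀ᶠ p : ℝ × ℝ in puncturedPairs, p.1 ≠ 0 :=
        tendsto_fst.eventually self_mem_nhdsWithin
      have h2 : ∀ᶠ p : ℝ × ℝ in puncturedPairs, p.2 ≠ 0 :=
        tendsto_snd.eventually self_mem_nhdsWithin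
      filter_upwards [h1, h2] with p h1 h2 using mul_ne_zero h1 h2
  have d3 := (tendsto_div_of_hasDerivAt (hasDerivAt_cexp_quadratic κ 0) (by simp)).comp hm
  -- With `f = ⟪F t, V⟫`, `g = ⟪V, G s⟫` and `e = exp (κ t s)`, the inner product of the increments
  -- is `f g e - f - g + 1 = (f - 1)(g - 1) + f g (e - 1)`; after division by `t s` each term is a
  -- product of known limits.
  have key := (d1.mul d2).add ((c1.mul c2).mul d3)
  simp only [Complex.ofReal_zero, mul_zero, ne_eq, OfNat.ofNat_ne_zero, not_false_eq_true,
    zero_pow, sub_self, Complex.exp_zero, one_mul] at key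
  refine key.congr fun p => ?_
  simp only [Function.comp, inner_smul_left, inner_smul_right, inner_sub_left, inner_sub_right,
    hFG, hF, hG, hV, Complex.conj_ofReal, mul_inv, Complex.ofReal_mul, zero_mul, sub_zero]
  ring

end DifferenceQuotients

/-! ### Moments of states with Gaussian characteristic function -/

section Moments

open Filter Topology

variable {α : Type} [Fintype α]

section Lift

variable {J : Type*}

/-- The family `(D_r vⱼ)ⱼ` as an element of the Hilbert sum, for a square-summable family `v`. -/
noncomputable def displacedFamily {v : J → HilbertSpace α} (hv : Summable fun j => ‖v j‖ ^ 2)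
    (r : PhaseSpace α) : lp (fun _ : J => HilbertSpace α) 2 :=
  ⟨fun j => displacement r (v j), memℓp_gen (by simpa [norm_displacement] using hv)⟩

lemma inner_displacedFamily {v : J → HilbertSpace α} {ρ : DensityOperator α}
    (h : IsEnsemble v ρ.op) (r s : PhaseSpace α) :
    ⟪displacedFamily h.summable r, displacedFamily h.summable s⟫_ℂ =
      Complex.exp (-(Complex.I * (weylPhase r s : ℂ))) * characteristicFunction ρ (s - r) := by
  rw [lp.inner_eq_tsum, characteristicFunction_eq_tsum h, ← tsum_mul_left]
  exact tsum_congr fun j => inner_displacement r s (v j) (v j)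

/-- For an orthonormal family `b`, the map `y ↦ (⟪x, bⱼ⟫ y)ⱼ` into the Hilbert sum. -/
noncomputable def spread {H : Type*} [NormedAddCommGroup H] [InnerProductSpace ℂ H]
    (b : HilbertBasis J ℂ H) (x : H) : H →L[ℂ] lp (fun _ : J => H) 2 :=
  LinearMap.mkContinuous
    { toFun := fun y => ⟨fun j => ⟪x, b j⟫_ℂ • y, memℓp_gen (by
        have := (hasSum_norm_inner_sq b x).summable.mul_right (‖y‖ ^ 2)
        simpa [norm_smul, mul_pow, norm_inner_symm] using this)⟩
      map_add' := fun y z => by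
        ext j
        exact smul_add _ _ _
      map_smul' := fun c y => by
        ext j
        exact smul_comm _ _ _ } ‖x‖ fun y => by
    rw [LinearMap.coe_mk, AddHom.coe_mk]
    refine le_of_sq_le_sq ?_ (by positivity)
    have h1 := lp.hasSum_norm (p := 2) (by simp) (E := fun _ : J => H)
      ⟨fun j => ⟪x, b j⟫_ℂ • y, memℓp_gen (by
        have := (hasSum_norm_inner_sq b x).summable.mul_right (‖y‖ ^ 2)
        simpa [norm_smul, mul_pow, norm_inner_symm] using this)⟩
    have h2 := (hasSum_norm_inner_sq b x).mul_right (‖y‖ ^ 2)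
    simp only [norm_smul, mul_pow, norm_inner_symm x, ENNReal.toReal_ofNat, Real.rpow_ofNat] at h1
    rw [mul_pow]
    exact (h1.unique h2).le

/-- The series `∑ ⟪bⱼ, x⟫ T bⱼ` recovers `T x` from the columns of `T`. Thus evaluation at any fixed
`x` is a bounded map on families of columns, and carries derivatives of such families to derivatives
at `x`. -/
lemma adjoint_spread_apply {H : Type*} [NormedAddCommGroup H] [InnerProductSpace ℂ H]
    [CompleteSpace H] (b : HilbertBasis J ℂ H) (x : H) (T : H →L[ℂ] H)
    (w : lp (fun _ : J => H) 2) (hw : ∀ j, w j = T (b j)) :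
    ContinuousLinearMap.adjoint (spread b x) w = T x := by
  refine ext_inner_left ℂ fun y => ?_
  rw [ContinuousLinearMap.adjoint_inner_right]
  have h1 := lp.hasSum_inner (𝕜 := ℂ) (spread b x y) w
  have h2 := ((b.hasSum_repr x).mapL T).mapL (innerSL ℂ y)
  refine h1.unique (h2.congr_fun fun j => ?_)
  rw [hw]
  simp [spread, inner_smul_left, b.repr_apply_apply]

end Lift

variable [DecidableEq α]

/-- `Ω` is itself a symplectic map. -/
lemma weylPhase_Omega_mulVec (u v : PhaseSpace α) :
    weylPhase (-(Omega α *ᵥ u)) (-(Omega α *ᵥ v)) = weylPhase u v := by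
  have h0 : ∀ (u : PhaseSpace α) j, (Omega α *ᵥ u) (j, 0) = u (j, 1) := fun u j => by
    simp [Omega, Matrix.mulVec, dotProduct, Fintype.sum_prod_type, Matrix.one_apply]
  have h1 : ∀ (u : PhaseSpace α) j, (Omega α *ᵥ u) (j, 1) = -u (j, 0) := fun u j => by
    simp [Omega, Matrix.mulVec, dotProduct, Fintype.sum_prod_type, Matrix.one_apply]
  simp only [weylPhase, Pi.neg_apply, h0, h1]
  congr 1
  exact Finset.sum_congr rfl fun j _ => by ring

lemma ofReal_smul_lp {α : Type} [Fintype α] {J : Type*} (c : ℝ) (x : lp (fun _ : J => HilbertSpace α) 2) :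
    (c : ℂ) • x = c • x := by
  ext1
  funext j
  exact Complex.coe_smul c (x j)

/-- The curve `t ↦ (D_{-tΩu} ρ^{1/2} bᵢ)ᵢ`. -/
noncomputable def weylCurve (ρ : DensityOperator α) (u : PhaseSpace α) (t : ℝ) :
    lp (fun _ : (exists_hilbertBasis ℂ (HilbertSpace α)).choose => HilbertSpace α) 2 :=
  displacedFamily ρ.isEnsemble.summable (-(t • (Omega α *ᵥ u)))

lemma weylCurve_zero (ρ : DensityOperator α) (u : PhaseSpace α) :
    weylCurve ρ u 0 = displacedFamily ρ.isEnsemble.summable 0 := by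
  rw [weylCurve, zero_smul, neg_zero]

lemma inner_weylCurve_left {ρ : DensityOperator α} {d : PhaseSpace α}
    {γ : Matrix (α × Fin 2) (α × Fin 2) ℝ} (hρ : HasGaussianChar ρ d γ)
    (u : PhaseSpace α) (t : ℝ) :
    ⟪weylCurve ρ u t, displacedFamily ρ.isEnsemble.summable 0⟫_ℂ =
      Complex.exp (-(Complex.I * ((u ⬝ᵥ d : ℝ) : ℂ)) * t -
        ((u ⬝ᵥ (γ *ᵥ u) / 4 : ℝ) : ℂ) * t ^ 2) := by
  have h0 : weylPhase (-(t • (Omega α *ᵥ u))) 0 = 0 := by simp [weylPhase]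
  rw [weylCurve, inner_displacedFamily ρ.isEnsemble, h0, zero_sub, ← mulVec_smul, ← mulVec_neg,
    hρ]
  simp only [Complex.ofReal_zero, mul_zero, neg_zero, Complex.exp_zero, one_mul, neg_dotProduct,
    smul_dotProduct, mulVec_neg, mulVec_smul, dotProduct_neg, dotProduct_smul, smul_eq_mul]
  congr 1
  push_cast
  ring

lemma inner_weylCurve_right {ρ : DensityOperator α} {d : PhaseSpace α}
    {γ : Matrix (α × Fin 2) (α × Fin 2) ℝ} (hρ : HasGaussianChar ρ d γ)
    (u : PhaseSpace α) (t : ℝ) :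
    ⟪displacedFamily ρ.isEnsemble.summable 0, weylCurve ρ u t⟫_ℂ =
      Complex.exp (Complex.I * ((u ⬝ᵥ d : ℝ) : ℂ) * t -
        ((u ⬝ᵥ (γ *ᵥ u) / 4 : ℝ) : ℂ) * t ^ 2) := by
  rw [← inner_conj_symm, inner_weylCurve_left hρ, ← Complex.exp_conj]
  congr 1
  simp [map_ofNat]

lemma inner_displacedFamily_zero {ρ : DensityOperator α} {d : PhaseSpace α}
    {γ : Matrix (α × Fin 2) (α × Fin 2) ℝ} (hρ : HasGaussianChar ρ d γ) :
    ⟪displacedFamily ρ.isEnsemble.summable 0, displacedFamily ρ.isEnsemble.summable 0⟫_ℂ = 1 := by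
  have := inner_weylCurve_right hρ 0 0
  rw [weylCurve_zero] at this
  rw [this]
  simp

lemma tendsto_inner_weylCurve {ρ : DensityOperator α} {d : PhaseSpace α}
    {γ : Matrix (α × Fin 2) (α × Fin 2) ℝ} (hγ : γ.IsSymm) (hρ : HasGaussianChar ρ d γ)
    (u v : PhaseSpace α) :
    Tendsto (fun p : ℝ × ℝ =>
      ⟪((p.1⁻¹ : ℝ) : ℂ) • (weylCurve ρ u p.1 - displacedFamily ρ.isEnsemble.summable 0),
        ((p.2⁻¹ : ℝ) : ℂ) • (weylCurve ρ v p.2 - displacedFamily ρ.isEnsemble.summable 0)⟫_ℂ)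
      puncturedPairs (𝓝 ((((u ⬝ᵥ d) * (v ⬝ᵥ d) + u ⬝ᵥ (γ *ᵥ v) / 2 : ℝ) : ℂ) -
        Complex.I * (weylPhase u v : ℂ))) := by
  have hsymm : v ⬝ᵥ (γ *ᵥ u) = u ⬝ᵥ (γ *ᵥ v) := by
    rw [dotProduct_mulVec, ← mulVec_transpose, hγ.eq, dotProduct_comm]
  -- The coupling `κ` collects the cross term of `(sv - tu)ᵀ γ (sv - tu) / 4` in `χ` and the Weyl
  -- phase; both are proportional to `t s`.
  have := tendsto_inner_quotients (κ := ((u ⬝ᵥ (γ *ᵥ v) / 2 : ℝ) : ℂ) -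
    Complex.I * (weylPhase u v : ℂ)) (inner_displacedFamily_zero hρ)
    (inner_weylCurve_left hρ u) (inner_weylCurve_right hρ v) fun t s => by
      rw [inner_weylCurve_left hρ, inner_weylCurve_right hρ, ← Complex.exp_add, ← Complex.exp_add,
        weylCurve, weylCurve, inner_displacedFamily ρ.isEnsemble, ← mulVec_smul, ← mulVec_smul,
        weylPhase_Omega_mulVec, weylPhase_smul_smul,
        show -(Omega α *ᵥ (s • v)) - -(Omega α *ᵥ (t • u)) = -(Omega α *ᵥ (s • v - t • u)) by
          rw [mulVec_sub]; abel, hρ, ← Complex.exp_add]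
      simp only [sub_dotProduct, mulVec_sub, dotProduct_sub, smul_dotProduct, mulVec_smul,
        dotProduct_smul, smul_eq_mul, hsymm]
      congr 1
      push_cast
      ring
  convert this using 2
  push_cast
  linear_combination (((u ⬝ᵥ d : ℝ) : ℂ)) * (((v ⬝ᵥ d : ℝ) : ℂ)) * Complex.I_sq

/-- The moments of a state with Gaussian characteristic function, in terms of the derivatives
`i (uᵀR) ρ^{1/2}` of the Weyl curves. -/
lemma exists_hasDerivAt_weylCurve {ρ : DensityOperator α} {d : PhaseSpace α}
    {γ : Matrix (α × Fin 2) (α × Fin 2) ℝ} (hγ : γ.IsSymm) (hρ : HasGaussianChar ρ d γ) :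
    ∃ Z : PhaseSpace α →
        lp (fun _ : (exists_hilbertBasis ℂ (HilbertSpace α)).choose => HilbertSpace α) 2,
      (∀ u, HasDerivAt (weylCurve ρ u) (Z u) 0) ∧
      (∀ u, ⟪displacedFamily ρ.isEnsemble.summable 0, Z u⟫_ℂ =
        Complex.I * ((u ⬝ᵥ d : ℝ) : ℂ)) ∧
      ∀ u v, ⟪Z u, Z v⟫_ℂ = (((u ⬝ᵥ d) * (v ⬝ᵥ d) + u ⬝ᵥ (γ *ᵥ v) / 2 : ℝ) : ℂ) -
        Complex.I * (weylPhase u v : ℂ) := by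
  have hZ := fun u => exists_tendsto_of_inner_tendsto (q := fun t : ℝ =>
    ((t⁻¹ : ℝ) : ℂ) • (weylCurve ρ u t - displacedFamily ρ.isEnsemble.summable 0))
    (tendsto_inner_weylCurve hγ hρ u u)
  choose Z hZ using hZ
  refine ⟨Z, fun u => ?_, fun u => ?_, fun u v => ?_⟩
  · rw [hasDerivAt_iff_tendsto_slope_zero]
    refine (hZ u).congr fun t => ?_
    rw [zero_add, weylCurve_zero, ofReal_smul_lp]
  · have h1 := (tendsto_const_nhds (x := displacedFamily ρ.isEnsemble.summable 0)).inner (𝕜 := ℂ)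
      (hZ u)
    refine tendsto_nhds_unique h1 ?_
    refine (tendsto_div_of_hasDerivAt (hasDerivAt_cexp_quadratic (Complex.I * ((u ⬝ᵥ d : ℝ) : ℂ))
      ((u ⬝ᵥ (γ *ᵥ u) / 4 : ℝ) : ℂ)) (by simp)).congr fun t => ?_
    rw [inner_smul_right, inner_sub_right, inner_weylCurve_right hρ,
      inner_displacedFamily_zero hρ]
  · exact tendsto_nhds_unique (((hZ u).comp tendsto_fst).inner ((hZ v).comp tendsto_snd))
      (tendsto_inner_weylCurve hγ hρ u v)

end Moments

/-! ### Expectations of linear observables -/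

section Observables

open Filter Topology

variable {α : Type} [Fintype α]

lemma tendsto_slope_map {J : Type*} {F : ℝ → lp (fun _ : J => HilbertSpace α) 2}
    {Z : lp (fun _ : J => HilbertSpace α) 2} (h : HasDerivAt F Z 0)
    (L : lp (fun _ : J => HilbertSpace α) 2 →L[ℂ] HilbertSpace α) :
    HasDerivAt (fun t => L (F t)) (L Z) 0 := by
  rw [hasDerivAt_iff_tendsto_slope_zero] at h ⊢
  refine ((L.continuous.tendsto Z).comp h).congr fun t => ?_
  rw [Function.comp, ← ofReal_smul_lp, map_smul, map_sub, Complex.coe_smul]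
  rfl

variable [DecidableEq α]

lemma applyOp_linearObservable {u : PhaseSpace α} {c : ℝ}
    {ψ D : HilbertSpace α}
    (h : HasDerivAt (fun t : ℝ => displacement (-(t • (Omega α *ᵥ u))) ψ) D 0) :
    applyOp (linearObservable u c) ψ = (c : ℂ) • ψ + -Complex.I • D := by
  have hd : ψ ∈ (linearObservable u c).domain := h.differentiableAt
  rw [applyOp, dif_pos hd, ← h.deriv]
  rfl

/-- The operators `(uᵀR + c) ρ^{1/2}` and their Hilbert-Schmidt inner products. -/
lemma exists_family_linearObservable {ρ : DensityOperator α} {d : PhaseSpace α}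
    {γ : Matrix (α × Fin 2) (α × Fin 2) ℝ} (hγ : γ.IsSymm) (hρ : HasGaussianChar ρ d γ) :
    ∃ P : PhaseSpace α → ℝ →
        lp (fun _ : (exists_hilbertBasis ℂ (HilbertSpace α)).choose => HilbertSpace α) 2,
      (∀ u c ψ, ρ.sqrt ψ ∈ (linearObservable u c).domain) ∧
      (∀ u c i, P u c i = applyOp (linearObservable u c) (ρ.sqrt (traceBasis α i))) ∧
      (∀ u c, ⟪displacedFamily ρ.isEnsemble.summable 0, P u c⟫_ℂ =
        ((u ⬝ᵥ d + c : ℝ) : ℂ)) ∧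
      ∀ u c v e, ⟪P u c, P v e⟫_ℂ =
        (((u ⬝ᵥ d + c) * (v ⬝ᵥ d + e) + u ⬝ᵥ (γ *ᵥ v) / 2 : ℝ) : ℂ) -
        Complex.I * (weylPhase u v : ℂ) := by
  obtain ⟨Z, hZ, h1, h2⟩ := exists_hasDerivAt_weylCurve hγ hρ
  have hV := inner_displacedFamily_zero hρ
  have h1' : ∀ u, ⟪Z u, displacedFamily ρ.isEnsemble.summable 0⟫_ℂ =
      -(Complex.I * ((u ⬝ᵥ d : ℝ) : ℂ)) := fun u => by
    rw [← inner_conj_symm, h1]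
    simp
  -- Since `Z u` is the derivative of `exp (i t uᵀR) ρ^{1/2}`, the family of `(uᵀR + c) ρ^{1/2}` is
  -- `c` times the undisplaced family plus `-i Z u`.
  refine ⟨fun u c => (c : ℂ) • displacedFamily ρ.isEnsemble.summable 0 + -Complex.I • Z u,
    fun u c ψ => ?_, fun u c i => ?_, fun u c => ?_, fun u c v e => ?_⟩
  -- For `ψ` outside the basis, the adjoint of `spread` reconstructs `D ρ^{1/2} ψ` from the columns
  -- and transports the derivative, so `ρ^{1/2} ψ` lies in the domain.
  · have h := tendsto_slope_map (hZ u)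
      (ContinuousLinearMap.adjoint (spread (traceBasis α) ψ))
    refine HasDerivAt.differentiableAt (h.congr_of_eventuallyEq (Eventually.of_forall fun t => ?_))
    exact (adjoint_spread_apply (traceBasis α) ψ
      (displacement (-(t • (Omega α *ᵥ u))) ∘L ρ.sqrt) (weylCurve ρ u t) fun j => rfl).symm
  -- On basis vectors it suffices to evaluate one coordinate of the Hilbert sum.
  · have h := tendsto_slope_map (hZ u) (lp.evalCLM ℂ (fun _ => HilbertSpace α) (p := 2) i)
    rw [applyOp_linearObservable (D := Z u i) h]
    change (c : ℂ) • displacement 0 _ + _ = _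
    rw [displacement_zero]
    rfl
  · rw [inner_add_right, inner_smul_right, inner_smul_right, hV, h1]
    push_cast
    linear_combination -((u ⬝ᵥ d : ℝ) : ℂ) * Complex.I_sq
  · simp only [inner_add_left, inner_add_right, inner_smul_left, inner_smul_right, hV, h1, h1', h2,
      map_neg, Complex.conj_I, Complex.conj_ofReal]
    push_cast
    linear_combination (-
      c * ((v ⬝ᵥ d : ℝ) : ℂ) - e * ((u ⬝ᵥ d : ℝ) : ℂ) - (((u ⬝ᵥ d : ℝ) : ℂ) * ((v ⬝ᵥ d : ℝ) : ℂ) +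
      ((u ⬝ᵥ (γ *ᵥ v) : ℝ) : ℂ) / 2 - Complex.I * (weylPhase u v : ℂ))) * Complex.I_sq

section Values

variable {ρ : DensityOperator α} {d : PhaseSpace α} {γ : Matrix (α × Fin 2) (α × Fin 2) ℝ}

lemma hasSecondMoment_linearObservable (hγ : γ.IsSymm) (hρ : HasGaussianChar ρ d γ)
    (u : PhaseSpace α) (c : ℝ) : HasSecondMoment ρ (linearObservable u c) := by
  obtain ⟨P, h0, hP, -, -⟩ := exists_family_linearObservable hγ hρ
  refine ⟨h0 u c, ?_⟩
  have := (lp.hasSum_norm (p := 2) (by simp) (P u c)).summable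
  simpa only [hP, ENNReal.toReal_ofNat, Real.rpow_ofNat] using this

lemma linearObservable_zero (u : PhaseSpace α) : linearObservable u 0 = quadrature u := by
  simp [linearObservable]

lemma hasSecondMoment_quadrature (hγ : γ.IsSymm) (hρ : HasGaussianChar ρ d γ)
    (u : PhaseSpace α) : HasSecondMoment ρ (quadrature u) := by
  rw [← linearObservable_zero]
  exact hasSecondMoment_linearObservable hγ hρ u 0

lemma expectation_linearObservable (hγ : γ.IsSymm) (hρ : HasGaussianChar ρ d γ)
    (u : PhaseSpace α) (c : ℝ) :
    expectation ρ (linearObservable u c) = ((u ⬝ᵥ d + c : ℝ) : ℂ) := by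
  obtain ⟨P, -, hP, h1, -⟩ := exists_family_linearObservable hγ hρ
  rw [← h1, lp.inner_eq_tsum, expectation]
  refine tsum_congr fun i => ?_
  rw [← hP]
  change _ = ⟪displacement 0 _, _⟫_ℂ
  rw [displacement_zero]

lemma expectationMul_linearObservable (hγ : γ.IsSymm) (hρ : HasGaussianChar ρ d γ)
    (u : PhaseSpace α) (c : ℝ) (v : PhaseSpace α) (e : ℝ) :
    expectationMul ρ (linearObservable u c) (linearObservable v e) =
      (((u ⬝ᵥ d + c) * (v ⬝ᵥ d + e) + u ⬝ᵥ (γ *ᵥ v) / 2 : ℝ) : ℂ) -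
        Complex.I * (weylPhase u v : ℂ) := by
  obtain ⟨P, -, hP, -, h2⟩ := exists_family_linearObservable hγ hρ
  rw [← h2, lp.inner_eq_tsum, expectationMul]
  simp only [hP]

lemma firstMoment_eq (hγ : γ.IsSymm) (hρ : HasGaussianChar ρ d γ) : firstMoment ρ = d := by
  ext k
  rw [firstMoment, ← linearObservable_zero, expectation_linearObservable hγ hρ]
  simp

/-- Centring removes the product of means, the Weyl phase is purely imaginary and drops out of the
real part, and the anticommutator adds two copies of `γₖₗ / 2`. -/
lemma covarianceMatrix_eq (hγ : γ.IsSymm) (hρ : HasGaussianChar ρ d γ) :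
    covarianceMatrix ρ = γ := by
  ext k l
  simp only [covarianceMatrix, of_apply, centredQuadrature, firstMoment_eq hγ hρ,
    expectationMul_linearObservable hγ hρ]
  simp [← hγ.apply k l]

end Values

end Observables

/-! ### The correlation values of a Gaussian state -/

section Correlation

variable {α β : Type} [Fintype α] [Fintype β]

/-- Quadratures of `A` commute with those of `B`, so the mixed expectations are real. -/
lemma weylPhase_leftCoeff_rightCoeff (x : PhaseSpace α) (y : PhaseSpace β) :
    weylPhase (leftCoeff x : PhaseSpace (α ⊕ β)) (rightCoeff y) = 0 := by
  simp [weylPhase, leftCoeff, rightCoeff]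

lemma leftCoeff_dotProduct_left (γ : Matrix ((α ⊕ β) × Fin 2) ((α ⊕ β) × Fin 2) ℝ)
    (x y : PhaseSpace α) :
    (leftCoeff x : PhaseSpace (α ⊕ β)) ⬝ᵥ (γ *ᵥ leftCoeff y) = x ⬝ᵥ (blockA γ *ᵥ y) := by
  simp [dotProduct, mulVec, leftCoeff, blockA, Fintype.sum_prod_type]

lemma leftCoeff_dotProduct_right (γ : Matrix ((α ⊕ β) × Fin 2) ((α ⊕ β) × Fin 2) ℝ)
    (x : PhaseSpace α) (y : PhaseSpace β) :
    (leftCoeff x : PhaseSpace (α ⊕ β)) ⬝ᵥ (γ *ᵥ rightCoeff y) = x ⬝ᵥ (blockAB γ *ᵥ y) := by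
  simp [dotProduct, mulVec, leftCoeff, rightCoeff, blockAB, Fintype.sum_prod_type]

lemma rightCoeff_dotProduct_right (γ : Matrix ((α ⊕ β) × Fin 2) ((α ⊕ β) × Fin 2) ℝ)
    (x y : PhaseSpace β) :
    (rightCoeff x : PhaseSpace (α ⊕ β)) ⬝ᵥ (γ *ᵥ rightCoeff y) = x ⬝ᵥ (blockB γ *ᵥ y) := by
  simp [dotProduct, mulVec, rightCoeff, blockB, Fintype.sum_prod_type]

variable [DecidableEq α] [DecidableEq β] {ρ : DensityOperator (α ⊕ β)} {d : PhaseSpace (α ⊕ β)}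
  {γ : Matrix ((α ⊕ β) × Fin 2) ((α ⊕ β) × Fin 2) ℝ}

/-- The `2` reflects the anticommutator convention, under which `γ` is twice the symmetrized second
moment. The finite second moment is automatic. -/
lemma isStandardized_linearObservable_iff {κ : Type} [Fintype κ] [DecidableEq κ]
    {ρ : DensityOperator κ} {d : PhaseSpace κ} {γ : Matrix (κ × Fin 2) (κ × Fin 2) ℝ}
    (hγ : γ.IsSymm) (hρ : HasGaussianChar ρ d γ) (u : PhaseSpace κ) (c : ℝ) :
    IsStandardized ρ (linearObservable u c) ↔ u ⬝ᵥ d + c = 0 ∧ u ⬝ᵥ (γ *ᵥ u) = 2 := by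
  rw [IsStandardized, expectation_linearObservable hγ hρ, expectationMul_linearObservable hγ hρ,
    weylPhase_self, Complex.ofReal_zero, mul_zero, sub_zero, Complex.ofReal_eq_zero,
    Complex.ofReal_eq_one]
  constructor
  · rintro ⟨-, h1, h2⟩
    refine ⟨h1, ?_⟩
    rw [h1] at h2
    linarith
  · rintro ⟨h1, h2⟩
    refine ⟨hasSecondMoment_linearObservable hγ hρ u c, h1, ?_⟩
    rw [h1, h2]
    norm_num

/-- The values `xᵀ N y / 2` for `xᵀ P x = yᵀ Q y = 2`. -/
def normalizedValues {m n : Type*} [Fintype m] [Fintype n] (P : Matrix m m ℝ) (Q : Matrix n n ℝ)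
    (N : Matrix m n ℝ) : Set ℝ :=
  {v | ∃ x y, x ⬝ᵥ (P *ᵥ x) = 2 ∧ y ⬝ᵥ (Q *ᵥ y) = 2 ∧ v = x ⬝ᵥ (N *ᵥ y) / 2}

/-- The correlation values of a state with Gaussian characteristic function, in terms of its
covariance matrix. -/
lemma correlationValues_eq (hγ : γ.IsSymm) (hρ : HasGaussianChar ρ d γ) :
    correlationValues ρ = normalizedValues (blockA γ) (blockB γ) (blockAB γ) := by
  ext v
  simp only [normalizedValues, correlationValues, observableA, observableB, isStandardized_linearObservable_iff hγ hρ,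
    expectationMul_linearObservable hγ hρ, weylPhase_leftCoeff_rightCoeff, Complex.ofReal_zero,
    mul_zero, sub_zero, Complex.ofReal_inj, leftCoeff_dotProduct_left, leftCoeff_dotProduct_right,
    rightCoeff_dotProduct_right, Set.mem_ofPred_eq]
  constructor
  · rintro ⟨x, c, y, e, ⟨h1, h2⟩, ⟨h3, h4⟩, rfl⟩
    exact ⟨x, y, h2, h4, by rw [h1]; ring⟩
  -- The additive constants are the ones that cancel the means.
  · rintro ⟨x, y, h2, h4, rfl⟩
    exact ⟨x, -(leftCoeff x ⬝ᵥ d), y, -(rightCoeff y ⬝ᵥ d), ⟨by ring, h2⟩, ⟨by ring, h4⟩, by ring⟩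

end Correlation

/-! ### Normalized values of a bilinear form -/

section NormalizedValues

lemma norm_toLp_sq {m : Type} [Fintype m] (a : m → ℝ) : ‖WithLp.toLp 2 a‖ ^ 2 = a ⬝ᵥ a := by
  rw [EuclideanSpace.real_norm_sq_eq]
  simp [dotProduct, sq]

lemma dotProduct_mulVec_eq_inner {m n : Type} [Fintype m] [Fintype n] [DecidableEq n]
    (M : Matrix m n ℝ) (a : m → ℝ) (b : n → ℝ) :
    a ⬝ᵥ (M *ᵥ b) = ⟪WithLp.toLp 2 a, toEuclideanLin M (WithLp.toLp 2 b)⟫_ℝ := by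
  rw [EuclideanSpace.inner_eq_star_dotProduct, dotProduct_comm]
  simp

/-- Replacing `y` by `-y` preserves the constraints and flips the value. -/
lemma nonneg_of_isGreatest_normalizedValues {m n : Type} [Fintype m] [Fintype n]
    {P : Matrix m m ℝ} {Q : Matrix n n ℝ} {N : Matrix m n ℝ} {c : ℝ}
    (hc : IsGreatest (normalizedValues P Q N) c) : 0 ≤ c := by
  obtain ⟨⟨x, y, hx, hy, h⟩, hub⟩ := hc
  have := hub ⟨x, -y, hx, by simpa [mulVec_neg] using hy, rfl⟩
  rw [mulVec_neg, dotProduct_neg] at this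
  linarith

variable {m n : Type} [Fintype m] [Fintype n] [DecidableEq m] [DecidableEq n]
  {P : Matrix m m ℝ} {Q : Matrix n n ℝ}

lemma invSqrt_mulVec_sqrt_mulVec (hP : P.PosDef) (x : m → ℝ) :
    invSqrt P *ᵥ (CFC.sqrt P *ᵥ x) = x := by
  rw [invSqrt, mulVec_mulVec, nonsing_inv_mul _ (isUnit_det_sqrt hP), one_mulVec]

lemma sqrt_mulVec_invSqrt_mulVec (hP : P.PosDef) (x : m → ℝ) :
    CFC.sqrt P *ᵥ (invSqrt P *ᵥ x) = x := by
  rw [invSqrt, mulVec_mulVec, mul_nonsing_inv _ (isUnit_det_sqrt hP), one_mulVec]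

lemma transpose_invSqrt (P : Matrix m m ℝ) : (invSqrt P)ᵀ = invSqrt P := by
  rw [invSqrt, transpose_nonsing_inv, transpose_sqrt]

lemma invSqrt_mulVec_dotProduct (P : Matrix m m ℝ) (Q : Matrix n n ℝ) (N : Matrix m n ℝ)
    (a : m → ℝ) (b : n → ℝ) :
    (invSqrt P *ᵥ a) ⬝ᵥ (N *ᵥ (invSqrt Q *ᵥ b)) = a ⬝ᵥ ((invSqrt P * N * invSqrt Q) *ᵥ b) := by
  rw [Matrix.mul_assoc, ← mulVec_mulVec, ← mulVec_mulVec, dotProduct_mulVec a, ← mulVec_transpose,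
    transpose_invSqrt]

/-- Compactness of the unit sphere in finite dimension. -/
lemma exists_norm_eq_opNorm [Nonempty n] (M : Matrix m n ℝ) :
    ∃ b : EuclideanSpace ℝ n, ‖b‖ = 1 ∧ ‖toEuclideanLin M b‖ = matrixOpNorm M := by
  set T := (toEuclideanLin M).toContinuousLinearMap with hT
  have hne : (Metric.sphere (0 : EuclideanSpace ℝ n) 1).Nonempty :=
    NormedSpace.sphere_nonempty.2 zero_le_one
  obtain ⟨b, hb, hmax⟩ := (isCompact_sphere (0 : EuclideanSpace ℝ n) 1).exists_isMaxOn hne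
    (T.continuous.norm.continuousOn)
  have hb1 : ‖b‖ = 1 := by simpa using hb
  refine ⟨b, hb1, le_antisymm ?_ ?_⟩
  · have := T.le_opNorm b
    rwa [hb1, mul_one] at this
  · refine ContinuousLinearMap.opNorm_le_bound _ (norm_nonneg _) fun x => ?_
    rcases eq_or_ne x 0 with rfl | hx
    · simp
    have hx' : ‖x‖ ≠ 0 := norm_ne_zero_iff.2 hx
    have h1 : ‖T (‖x‖⁻¹ • x)‖ ≤ ‖T b‖ := hmax (by simp [norm_smul, hx'])
    rw [map_smul, norm_smul, norm_inv, norm_norm] at h1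
    have h2 := mul_le_mul_of_nonneg_left h1 (norm_nonneg x)
    rw [← mul_assoc, mul_inv_cancel₀ hx', one_mul] at h2
    rw [mul_comm]
    exact h2

/-- In the variables `a = P^{1/2} x`, `b = Q^{1/2} y` both constraints become `‖·‖² = 2`, and the
form becomes `⟪a, M b⟫` with `M = P^{-1/2} N Q^{-1/2}`. -/
lemma isGreatest_normalizedValues [Nonempty m] [Nonempty n] (hP : P.PosDef) (hQ : Q.PosDef)
    (N : Matrix m n ℝ) :
    IsGreatest (normalizedValues P Q N) (matrixOpNorm (invSqrt P * N * invSqrt Q)) := by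
  set M := invSqrt P * N * invSqrt Q with hM
  constructor
  · obtain ⟨b, hb, hMb⟩ := exists_norm_eq_opNorm M
    obtain ⟨a, ha, hab⟩ : ∃ a : EuclideanSpace ℝ m, ‖a‖ = 1 ∧
        ⟪a, toEuclideanLin M b⟫_ℝ = matrixOpNorm M := by
      -- The best `a` is the direction of `M b`. If `M b = 0` the norm is zero and any unit vector
      -- serves.
      by_cases h0 : toEuclideanLin M b = 0
      · obtain ⟨a, ha⟩ := NormedSpace.sphere_nonempty (E := EuclideanSpace ℝ m) (x := 0)
          |>.2 zero_le_one
        refine ⟨a, by simpa using ha, ?_⟩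
        rw [← hMb, h0, inner_zero_right, norm_zero]
      · have h1 : ‖toEuclideanLin M b‖ ≠ 0 := norm_ne_zero_iff.2 h0
        refine ⟨‖toEuclideanLin M b‖⁻¹ • toEuclideanLin M b, ?_, ?_⟩
        · rw [norm_smul, norm_inv, norm_norm, inv_mul_cancel₀ h1]
        · rw [inner_smul_left, real_inner_self_eq_norm_sq, ← hMb]
          simp only [conj_trivial]
          field_simp
    refine ⟨invSqrt P *ᵥ (Real.sqrt 2 • a.ofLp), invSqrt Q *ᵥ (Real.sqrt 2 • b.ofLp), ?_, ?_, ?_⟩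
    · rw [dotProduct_mulVec_eq_sqrt hP, sqrt_mulVec_invSqrt_mulVec hP, ← norm_toLp_sq,
        WithLp.toLp_smul, norm_smul, mul_pow, WithLp.toLp_ofLp, ha]
      simp
    · rw [dotProduct_mulVec_eq_sqrt hQ, sqrt_mulVec_invSqrt_mulVec hQ, ← norm_toLp_sq,
        WithLp.toLp_smul, norm_smul, mul_pow, WithLp.toLp_ofLp, hb]
      simp
    · rw [invSqrt_mulVec_dotProduct, mulVec_smul, smul_dotProduct, dotProduct_smul,
        dotProduct_mulVec_eq_inner, WithLp.toLp_ofLp, WithLp.toLp_ofLp, ← hM, hab, smul_eq_mul,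
        smul_eq_mul, ← mul_assoc, Real.mul_self_sqrt (by norm_num)]
      ring
  · rintro v ⟨x, y, hx, hy, rfl⟩
    rw [dotProduct_mulVec_eq_sqrt hP, ← norm_toLp_sq] at hx
    rw [dotProduct_mulVec_eq_sqrt hQ, ← norm_toLp_sq] at hy
    set a := WithLp.toLp 2 (CFC.sqrt P *ᵥ x) with ha
    set b := WithLp.toLp 2 (CFC.sqrt Q *ᵥ y) with hb
    have h1 : x ⬝ᵥ (N *ᵥ y) = ⟪a, toEuclideanLin M b⟫_ℝ := by
      rw [ha, hb, ← dotProduct_mulVec_eq_inner, hM, ← invSqrt_mulVec_dotProduct,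
        invSqrt_mulVec_sqrt_mulVec hP, invSqrt_mulVec_sqrt_mulVec hQ]
    have h2 : ‖toEuclideanLin M b‖ ≤ matrixOpNorm M * ‖b‖ :=
      (toEuclideanLin M).toContinuousLinearMap.le_opNorm b
    have h3 := real_inner_le_norm a (toEuclideanLin M b)
    have h4 : ‖a‖ * ‖toEuclideanLin M b‖ ≤ ‖a‖ * (matrixOpNorm M * ‖b‖) := by gcongr
    have h5 : ‖a‖ = ‖b‖ := by
      rw [← Real.sqrt_sq (norm_nonneg a), hx, ← hy, Real.sqrt_sq (norm_nonneg b)]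
    rw [h1]
    have h6 : ‖a‖ * (matrixOpNorm M * ‖b‖) = 2 * matrixOpNorm M := by
      rw [h5, ← hy]; ring
    linarith

/-- The homogeneous form of an upper bound on normalized values. -/
lemma dotProduct_mulVec_le_of_isGreatest (hP : P.PosDef) (hQ : Q.PosDef) {N : Matrix m n ℝ} {c : ℝ}
    (hc : IsGreatest (normalizedValues P Q N) c) (x : m → ℝ) (y : n → ℝ) :
    x ⬝ᵥ (N *ᵥ y) ≤ c * (Real.sqrt (x ⬝ᵥ (P *ᵥ x)) * Real.sqrt (y ⬝ᵥ (Q *ᵥ y))) := by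
  rcases eq_or_ne x 0 with rfl | hx
  · simp
  rcases eq_or_ne y 0 with rfl | hy
  · simp
  have hp : 0 < x ⬝ᵥ (P *ᵥ x) := by simpa using hP.dotProduct_mulVec_pos hx
  have hq : 0 < y ⬝ᵥ (Q *ᵥ y) := by simpa using hQ.dotProduct_mulVec_pos hy
  set p := x ⬝ᵥ (P *ᵥ x) with hpdef
  set q := y ⬝ᵥ (Q *ᵥ y) with hqdef
  have hp' := Real.sqrt_pos.2 hp
  have hq' := Real.sqrt_pos.2 hq
  have h2 := Real.mul_self_sqrt (show (0 : ℝ) ≤ 2 by norm_num)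
  have hpp := Real.mul_self_sqrt hp.le
  have hqq := Real.mul_self_sqrt hq.le
  have key := hc.2 ⟨(Real.sqrt 2 / Real.sqrt p) • x, (Real.sqrt 2 / Real.sqrt q) • y, by
      rw [mulVec_smul, smul_dotProduct, dotProduct_smul, ← hpdef, smul_eq_mul, smul_eq_mul]
      field_simp
      rw [sq, h2, sq, hpp, mul_comm], by
      rw [mulVec_smul, smul_dotProduct, dotProduct_smul, ← hqdef, smul_eq_mul, smul_eq_mul]
      field_simp
      rw [sq, h2, sq, hqq, mul_comm], rfl⟩
  rw [mulVec_smul, smul_dotProduct, dotProduct_smul, smul_eq_mul, smul_eq_mul] at key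
  have e : Real.sqrt 2 / Real.sqrt p * (Real.sqrt 2 / Real.sqrt q * x ⬝ᵥ (N *ᵥ y)) / 2 =
      x ⬝ᵥ (N *ᵥ y) / (Real.sqrt p * Real.sqrt q) := by
    field_simp
    rw [sq, h2, mul_comm]
  rwa [e, div_le_iff₀ (mul_pos hp' hq')] at key

end NormalizedValues

/-! ### The norm formula and the standard form -/

section NormFormula

lemma isSymm_of_posDef {n : Type*} [Fintype n] {γ : Matrix n n ℝ} (h : γ.PosDef) : γ.IsSymm := by
  simpa [Matrix.IsHermitian, Matrix.IsSymm] using h.1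

lemma posDef_blockA {α β : Type} {γ : Matrix ((α ⊕ β) × Fin 2) ((α ⊕ β) × Fin 2) ℝ}
    (h : γ.PosDef) : (blockA γ).PosDef :=
  h.submatrix (Sum.inl_injective.prodMap Function.injective_id)

lemma posDef_blockB {α β : Type} {γ : Matrix ((α ⊕ β) × Fin 2) ((α ⊕ β) × Fin 2) ℝ}
    (h : γ.PosDef) : (blockB γ).PosDef :=
  h.submatrix (Sum.inr_injective.prodMap Function.injective_id)

variable {α β : Type} [Fintype α] [DecidableEq α] [Fintype β] [DecidableEq β]
  {ρ : DensityOperator (α ⊕ β)} {d : PhaseSpace (α ⊕ β)}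
  {γ : Matrix ((α ⊕ β) × Fin 2) ((α ⊕ β) × Fin 2) ℝ}

lemma isGreatest_gaussianMaximalCorrelation [Nonempty α] [Nonempty β] (hγ : γ.PosDef)
    (hρ : HasGaussianChar ρ d γ) :
    IsGreatest (normalizedValues (blockA γ) (blockB γ) (blockAB γ))
      (gaussianMaximalCorrelation ρ) := by
  have h := isGreatest_normalizedValues (posDef_blockA hγ) (posDef_blockB hγ) (blockAB γ)
  rwa [gaussianMaximalCorrelation, correlationValues_eq (isSymm_of_posDef hγ) hρ, h.csSup_eq]

lemma gaussianMaximalCorrelation_eq_opNorm [Nonempty α] [Nonempty β] (hγ : γ.PosDef)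
    (hρ : HasGaussianChar ρ d γ) :
    gaussianMaximalCorrelation ρ =
      matrixOpNorm (invSqrt (blockA γ) * blockAB γ * invSqrt (blockB γ)) :=
  (isGreatest_gaussianMaximalCorrelation hγ hρ).unique
    (isGreatest_normalizedValues (posDef_blockA hγ) (posDef_blockB hγ) (blockAB γ))

/-- Identifies the matrix in the Gaussian density with the covariance matrix defined by traces. -/
lemma IsGaussian.exists_hasGaussianChar {κ : Type} [Fintype κ] [DecidableEq κ]
    {ρ : DensityOperator κ} (h : IsGaussian ρ) :
    ∃ d, (covarianceMatrix ρ).PosDef ∧ HasGaussianChar ρ d (covarianceMatrix ρ) := by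
  obtain ⟨d, γ, hγ, hW⟩ := h
  have hχ := exists_hasGaussianChar_of_wignerFunction hγ hW
  rw [covarianceMatrix_eq (isSymm_of_posDef hγ) hχ]
  exact ⟨d, hγ, hχ⟩

/-- Both constraints are multiples of Euclidean norms, so bounding `|ν₂|` by `|ν₁|` and applying
Cauchy-Schwarz in the plane suffices; no matrix square root is needed. -/
lemma isGreatest_normalizedValues_standardForm {lamA lamB ν₁ ν₂ : ℝ} (hA : 0 < lamA)
    (hB : 0 < lamB) (hν : |ν₂| ≤ |ν₁|) :
    IsGreatest (normalizedValues (blockA (standardForm lamA lamB ν₁ ν₂))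
      (blockB (standardForm lamA lamB ν₁ ν₂)) (blockAB (standardForm lamA lamB ν₁ ν₂)))
      (|ν₁| / Real.sqrt (lamA * lamB)) := by
  have eA : ∀ x : PhaseSpace Unit, x ⬝ᵥ (blockA (standardForm lamA lamB ν₁ ν₂) *ᵥ x) =
      lamA * (x ((), 0) ^ 2 + x ((), 1) ^ 2) := fun x => by
    simp [blockA, standardForm, dotProduct, mulVec, Fintype.sum_prod_type, Fin.sum_univ_two,
      Matrix.one_apply]
    ring
  have eB : ∀ x : PhaseSpace Unit, x ⬝ᵥ (blockB (standardForm lamA lamB ν₁ ν₂) *ᵥ x) =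
      lamB * (x ((), 0) ^ 2 + x ((), 1) ^ 2) := fun x => by
    simp [blockB, standardForm, dotProduct, mulVec, Fintype.sum_prod_type, Fin.sum_univ_two,
      Matrix.one_apply]
    ring
  have eN : ∀ x y : PhaseSpace Unit, x ⬝ᵥ (blockAB (standardForm lamA lamB ν₁ ν₂) *ᵥ y) =
      ν₁ * (x ((), 0) * y ((), 0)) + ν₂ * (x ((), 1) * y ((), 1)) := fun x y => by
    simp [blockAB, standardForm, dotProduct, mulVec, Fintype.sum_prod_type, Fin.sum_univ_two,
      Matrix.diagonal_apply]
    ring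
  have hAB : 0 < Real.sqrt (lamA * lamB) := Real.sqrt_pos.2 (mul_pos hA hB)
  constructor
  · obtain ⟨s, hs, hsν⟩ : ∃ s : ℝ, s ^ 2 = 1 ∧ s * ν₁ = |ν₁| := by
      rcases le_total 0 ν₁ with h | h
      · exact ⟨1, by norm_num, by rw [abs_of_nonneg h, one_mul]⟩
      · exact ⟨-1, by norm_num, by rw [abs_of_nonpos h, neg_one_mul]⟩
    have hsA := Real.sq_sqrt (show 0 ≤ 2 / lamA by positivity)
    have hsB := Real.sq_sqrt (show 0 ≤ 2 / lamB by positivity)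
    -- The optimum uses only the position quadratures, where the coupling is `ν₁`; the sign `s`
    -- makes the value nonnegative.
    refine ⟨fun k => ![Real.sqrt (2 / lamA), 0] k.2, fun k => ![s * Real.sqrt (2 / lamB), 0] k.2,
      ?_, ?_, ?_⟩
    · rw [eA]
      simp only [cons_val_zero, cons_val_one, hsA]
      field_simp
      ring
    · rw [eB]
      simp only [cons_val_zero, cons_val_one, mul_pow, hs, hsB]
      field_simp
      ring
    · rw [eN]
      simp only [cons_val_zero, cons_val_one]
      have h1 : Real.sqrt (2 / lamA) * Real.sqrt (2 / lamB) = 2 / Real.sqrt (lamA * lamB) := by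
        rw [← Real.sqrt_mul (by positivity), div_mul_div_comm, Real.sqrt_div (by positivity),
          Real.sqrt_mul_self (by norm_num)]
      rw [← hsν]
      linear_combination (-(s * ν₁) / 2) * h1
  · rintro v ⟨x, y, hx, hy, rfl⟩
    rw [eA] at hx
    rw [eB] at hy
    rw [eN, div_le_div_iff₀ two_pos hAB]
    set a := x ((), 0)
    set b := x ((), 1)
    set c := y ((), 0)
    set e := y ((), 1)
    have h1 : ν₁ * (a * c) + ν₂ * (b * e) ≤ |ν₁| * (|a * c| + |b * e|) := by
      have h2 : ν₁ * (a * c) ≤ |ν₁| * |a * c| := by rw [← abs_mul]; exact le_abs_self _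
      have h3 : ν₂ * (b * e) ≤ |ν₂| * |b * e| := by rw [← abs_mul]; exact le_abs_self _
      have h4 : |ν₂| * |b * e| ≤ |ν₁| * |b * e| := by gcongr
      linarith
    have h5 : (|a * c| + |b * e|) * Real.sqrt (lamA * lamB) ≤ 2 := by
      refine abs_le_of_sq_le_sq' ?_ (by norm_num) |>.2
      rw [mul_pow, Real.sq_sqrt (mul_pos hA hB).le]
      have h6 : (|a * c| + |b * e|) ^ 2 ≤ (a ^ 2 + b ^ 2) * (c ^ 2 + e ^ 2) := by
        rw [abs_mul, abs_mul]
        nlinarith [sq_nonneg (|a| * |e| - |b| * |c|), sq_abs a, sq_abs b, sq_abs c, sq_abs e]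
      calc _ ≤ (a ^ 2 + b ^ 2) * (c ^ 2 + e ^ 2) * (lamA * lamB) := by gcongr
        _ = (lamA * (a ^ 2 + b ^ 2)) * (lamB * (c ^ 2 + e ^ 2)) := by ring
        _ = 2 ^ 2 := by rw [hx, hy]; norm_num
    calc _ ≤ |ν₁| * (|a * c| + |b * e|) * Real.sqrt (lamA * lamB) := by gcongr
      _ ≤ |ν₁| * 2 := by rw [mul_assoc]; gcongr

lemma gaussianMaximalCorrelation_standardForm {ρ : DensityOperator (Unit ⊕ Unit)}
    {d : PhaseSpace (Unit ⊕ Unit)} {lamA lamB ν₁ ν₂ : ℝ}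
    (hγ : (standardForm lamA lamB ν₁ ν₂).PosDef)
    (hρ : HasGaussianChar ρ d (standardForm lamA lamB ν₁ ν₂)) (hν : |ν₂| ≤ |ν₁|) :
    gaussianMaximalCorrelation ρ = |ν₁| / Real.sqrt (lamA * lamB) := by
  have hA : 0 < lamA := by
    simpa [standardForm] using hγ.diag_pos (i := (Sum.inl (), 0))
  have hB : 0 < lamB := by
    simpa [standardForm] using hγ.diag_pos (i := (Sum.inr (), 0))
  exact (isGreatest_gaussianMaximalCorrelation hγ hρ).unique
    (isGreatest_normalizedValues_standardForm hA hB hν)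

end NormFormula

/-! ### Sums over product index sets -/

section PiSums

open Filter Topology

variable {ι : Type*} [Fintype ι] {I : ι → Type*}

/-- A finite set of multi-indices lies in the box spanned by its coordinate projections, and on a
box the sum factors. -/
lemma summable_pi_prod {f : ∀ i, I i → ℝ} (h0 : ∀ i k, 0 ≤ f i k) (hf : ∀ i, Summable (f i)) :
    Summable fun J : ∀ i, I i => ∏ i, f i (J i) := by
  classical
  refine summable_of_sum_le (c := ∏ i, ∑' k, f i k)
    (fun J => Finset.prod_nonneg fun i _ => h0 i _) fun u => ?_
  calc ∑ J ∈ u, ∏ i, f i (J i)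
      ≤ ∑ J ∈ Fintype.piFinset fun i => u.image fun J => J i, ∏ i, f i (J i) := by
        refine Finset.sum_le_sum_of_subset_of_nonneg (fun J hJ => ?_)
          fun J _ _ => Finset.prod_nonneg fun i _ => h0 i _
        exact Fintype.mem_piFinset.2 fun i => Finset.mem_image_of_mem _ hJ
    _ = ∏ i, ∑ k ∈ u.image fun J => J i, f i k := (Finset.prod_univ_sum _ _).symm
    _ ≤ _ := Finset.prod_le_prod (fun i _ => Finset.sum_nonneg fun k _ => h0 i k)
        fun i _ => (hf i).sum_le_tsum _ fun k _ => h0 i k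

/-- Absolute summability allows the sum to be computed along boxes, where it is a product of finite
sums. -/
lemma hasSum_pi_prod {f : ∀ i, I i → ℂ} {a : ι → ℂ} (hs : ∀ i, Summable fun k => ‖f i k‖)
    (hf : ∀ i, HasSum (f i) (a i)) :
    HasSum (fun J : ∀ i, I i => ∏ i, f i (J i)) (∏ i, a i) := by
  classical
  have hsum : Summable fun J : ∀ i, I i => ∏ i, f i (J i) := by
    refine Summable.of_norm ?_
    simpa only [norm_prod] using summable_pi_prod (fun i k => norm_nonneg _) hs
  have h1 : Tendsto (fun u : ∀ i, Finset (I i) => ∑ J ∈ Fintype.piFinset u, ∏ i, f i (J i)) atTop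
      (𝓝 (∏ i, a i)) := by
    simp only [← Finset.prod_univ_sum]
    refine tendsto_finsetProd _ fun i _ => ?_
    -- To make the `i`-th side of the box exceed `s`, start from `s` in coordinate `i` and the empty
    -- set elsewhere.
    exact (hf i).comp (tendsto_atTop_atTop.2 fun s => ⟨fun i' => if h : i' = i then h ▸ s else ∅,
      fun u hu => by simpa using hu i⟩)
  have h2 : Tendsto (fun u : ∀ i, Finset (I i) => Fintype.piFinset u) atTop atTop := by
    refine tendsto_atTop_atTop.2 fun s => ⟨fun i => s.image fun J => J i, fun u hu J hJ => ?_⟩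
    exact Fintype.mem_piFinset.2 fun i => hu i (Finset.mem_image_of_mem _ hJ)
  have h3 := tendsto_nhds_unique (hsum.hasSum.comp h2) h1
  rw [← h3]
  exact hsum.hasSum

end PiSums

/-! ### Product vectors -/

section ProductVectors

open Filter Topology

variable {ι : Type} [Fintype ι] {κ : ι → Type} {K : Type}

/-- The splitting of the coordinates indexed by `K` into those of the subsystems. -/
noncomputable def splitEquiv {j : ∀ i, κ i → K}
    (hj : Function.Bijective fun p : Σ i, κ i => j p.1 p.2) :
    (K → ℝ) ≃ᵐ (∀ i, κ i → ℝ) where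
  toFun x i k := x (j i k)
  invFun y k := y ((Equiv.ofBijective _ hj).symm k).1 ((Equiv.ofBijective _ hj).symm k).2
  left_inv x := by
    ext k
    exact congrArg x ((Equiv.ofBijective _ hj).apply_symm_apply k)
  right_inv y := by
    funext i k
    have h := (Equiv.ofBijective _ hj).symm_apply_apply ⟨i, k⟩
    change y ((Equiv.ofBijective _ hj).symm ((Equiv.ofBijective _ hj) ⟨i, k⟩)).1
      ((Equiv.ofBijective _ hj).symm ((Equiv.ofBijective _ hj) ⟨i, k⟩)).2 = _
    rw [h]
  measurable_toFun := by
    refine measurable_pi_lambda _ fun i => measurable_pi_lambda _ fun k => measurable_pi_apply _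
  measurable_invFun := by
    refine measurable_pi_lambda _ fun k => ?_
    exact (measurable_pi_apply ((Equiv.ofBijective _ hj).symm k).2).comp
      (measurable_pi_apply (X := fun i => κ i → ℝ) ((Equiv.ofBijective _ hj).symm k).1)

variable [∀ i, Fintype (κ i)] [Fintype K] {j : ∀ i, κ i → K}

lemma prod_eq_prod_prod {M : Type*} [CommMonoid M]
    (hj : Function.Bijective fun p : Σ i, κ i => j p.1 p.2) (f : K → M) :
    ∏ k, f k = ∏ i, ∏ k, f (j i k) := by
  rw [← Fintype.prod_sigma' (f := fun i k => f (j i k))]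
  exact (Fintype.prod_bijective _ hj _ _ fun p => rfl).symm

lemma sum_eq_sum_sum {M : Type*} [AddCommMonoid M]
    (hj : Function.Bijective fun p : Σ i, κ i => j p.1 p.2) (f : K → M) :
    ∑ k, f k = ∑ i, ∑ k, f (j i k) :=
  prod_eq_prod_prod (M := Multiplicative M) hj f

lemma measurePreserving_splitEquiv (hj : Function.Bijective fun p : Σ i, κ i => j p.1 p.2) :
    MeasurePreserving (splitEquiv hj) volume volume := by
  refine MeasurePreserving.symm (splitEquiv hj).symm ⟨(splitEquiv hj).symm.measurable, ?_⟩
  refine (Measure.pi_eq (μ := fun _ : K => (volume : Measure ℝ)) fun s hs => ?_).symm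
  rw [Measure.map_apply (splitEquiv hj).symm.measurable (MeasurableSet.univ_pi hs)]
  have e : (splitEquiv hj).symm ⁻¹' Set.univ.pi s =
      Set.univ.pi fun i => Set.univ.pi fun k => s (j i k) := by
    ext y
    constructor
    · intro h i _ k _
      have := h (j i k) (Set.mem_univ _)
      have e2 := congrFun (congrFun ((splitEquiv hj).apply_symm_apply y) i) k
      rwa [← e2]
    · intro h k _
      obtain ⟨⟨i, k⟩, rfl⟩ := hj.2 k
      have := h i (Set.mem_univ _) k (Set.mem_univ _)
      have e2 := congrFun (congrFun ((splitEquiv hj).apply_symm_apply y) i) k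
      rwa [← e2] at this
  rw [e, volume_pi_pi, prod_eq_prod_prod hj]
  exact Finset.prod_congr rfl fun i _ => volume_pi_pi _

lemma integral_prod_split (hj : Function.Bijective fun p : Σ i, κ i => j p.1 p.2)
    (g : ∀ i, (κ i → ℝ) → ℂ) :
    ∫ x : K → ℝ, ∏ i, g i (fun k => x (j i k)) = ∏ i, ∫ y, g i y := by
  rw [← integral_fintype_prod_volume_eq_prod]
  exact (measurePreserving_splitEquiv hj).integral_comp' (g := fun y : ∀ i, κ i → ℝ =>
    ∏ i, g i (y i))

lemma integrable_prod_split (hj : Function.Bijective fun p : Σ i, κ i => j p.1 p.2)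
    {g : ∀ i, (κ i → ℝ) → ℝ} (hg : ∀ i, Integrable (g i)) :
    Integrable fun x : K → ℝ => ∏ i, g i (fun k => x (j i k)) :=
  (measurePreserving_splitEquiv hj).integrable_comp_emb (splitEquiv hj).measurableEmbedding |>.2
    (Integrable.fintype_prod_dep hg)

/-- Coordinate projections do not preserve Lebesgue measure in general, but they pull null sets back
to null sets, which is enough for almost-everywhere identities between `Lp` representatives. -/
lemma quasiMeasurePreserving_component (hj : Function.Bijective fun p : Σ i, κ i => j p.1 p.2)
    (i : ι) : Measure.QuasiMeasurePreserving (fun (x : K → ℝ) (k : κ i) => x (j i k))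
      volume volume :=
  (Measure.quasiMeasurePreserving_eval (fun i => (volume : Measure (κ i → ℝ))) i).comp
    (measurePreserving_splitEquiv hj).quasiMeasurePreserving

lemma memLp_prod (hj : Function.Bijective fun p : Σ i, κ i => j p.1 p.2)
    (f : ∀ i, HilbertSpace (κ i)) :
    MemLp (fun x : K → ℝ => ∏ i, f i (fun k => x (j i k))) 2 volume := by
  have hm : AEStronglyMeasurable (fun x : K → ℝ => ∏ i, f i (fun k => x (j i k))) volume := by
    refine Finset.aestronglyMeasurable_fun_prod _ fun i _ => ?_
    exact (Lp.aestronglyMeasurable (f i)).comp_quasiMeasurePreserving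
      (quasiMeasurePreserving_component hj i)
  rw [memLp_two_iff_integrable_sq_norm hm]
  simp only [norm_prod, ← Finset.prod_pow]
  exact integrable_prod_split hj (g := fun i y => ‖f i y‖ ^ 2)
    fun i => (memLp_two_iff_integrable_sq_norm (Lp.aestronglyMeasurable _)).1 (Lp.memLp _)

/-- The product vector `⨂ᵢ fᵢ`. -/
noncomputable def productVector (hj : Function.Bijective fun p : Σ i, κ i => j p.1 p.2)
    (f : ∀ i, HilbertSpace (κ i)) : HilbertSpace K :=
  (memLp_prod hj f).toLp _

lemma coeFn_productVector (hj : Function.Bijective fun p : Σ i, κ i => j p.1 p.2)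
    (f : ∀ i, HilbertSpace (κ i)) :
    productVector hj f =ᵐ[volume] fun x => ∏ i, f i (fun k => x (j i k)) :=
  (memLp_prod hj f).coeFn_toLp

lemma eq_productVector_iff (hj : Function.Bijective fun p : Σ i, κ i => j p.1 p.2)
    (f : ∀ i, HilbertSpace (κ i)) (F : HilbertSpace K) :
    F = productVector hj f ↔ F =ᵐ[volume] fun x => ∏ i, f i (fun k => x (j i k)) :=
  ⟨fun h => h ▸ coeFn_productVector hj f, fun h => Lp.ext (h.trans (coeFn_productVector hj f).symm)⟩

lemma inner_productVector (hj : Function.Bijective fun p : Σ i, κ i => j p.1 p.2)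
    (f g : ∀ i, HilbertSpace (κ i)) :
    ⟪productVector hj f, productVector hj g⟫_ℂ = ∏ i, ⟪f i, g i⟫_ℂ := by
  simp only [L2.inner_def]
  rw [← integral_prod_split hj]
  refine integral_congr_ae ?_
  filter_upwards [coeFn_productVector hj f, coeFn_productVector hj g] with x hf hg
  simp only [hf, hg, RCLike.inner_apply, map_prod, Finset.prod_mul_distrib]

lemma norm_productVector_sq (hj : Function.Bijective fun p : Σ i, κ i => j p.1 p.2)
    (f : ∀ i, HilbertSpace (κ i)) : ‖productVector hj f‖ ^ 2 = ∏ i, ‖f i‖ ^ 2 := by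
  have h := inner_productVector hj f f
  simp only [inner_self_eq_ofReal_norm_sq] at h
  exact_mod_cast h

lemma phase_eq_sum (hj : Function.Bijective fun p : Σ i, κ i => j p.1 p.2)
    (r : PhaseSpace K) (x : K → ℝ) :
    phase r x = ∑ i, phase (fun p : κ i × Fin 2 => r (j i p.1, p.2)) (fun k => x (j i k)) := by
  simp only [phase, Finset.sum_sub_distrib, ← Finset.sum_div]
  rw [sum_eq_sum_sum hj, sum_eq_sum_sum hj]

/-- Translation acts on each group of coordinates and the phase is additive over modes. -/
lemma displacement_productVector (hj : Function.Bijective fun p : Σ i, κ i => j p.1 p.2)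
    (r : PhaseSpace K) (f : ∀ i, HilbertSpace (κ i)) :
    displacement r (productVector hj f) =
      productVector hj fun i => displacement (fun p : κ i × Fin 2 => r (j i p.1, p.2)) (f i) := by
  rw [eq_productVector_iff]
  have hq := (measurePreserving_sub_right (volume : Measure (K → ℝ))
    fun k => r (k, 0)).quasiMeasurePreserving
  have h3 : ∀ᵐ x : K → ℝ, ∀ i,
      displacement (fun p : κ i × Fin 2 => r (j i p.1, p.2)) (f i) (fun k => x (j i k)) = _ :=
    ae_all_iff.2 fun i => (quasiMeasurePreserving_component hj i).ae
      (coeFn_displacement (fun p : κ i × Fin 2 => r (j i p.1, p.2)) (f i))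
  filter_upwards [coeFn_displacement r (productVector hj f), hq.ae (coeFn_productVector hj f), h3]
    with x h1 h2 h3
  rw [h1, h2]
  simp only [h3, Finset.prod_mul_distrib, ← Complex.exp_sum, ← Finset.mul_sum]
  rw [phase_eq_sum hj, Complex.ofReal_sum]
  rfl

/-- A vector orthogonal to all product vectors vanishes. -/
lemma eq_zero_of_inner_productVector (hj : Function.Bijective fun p : Σ i, κ i => j p.1 p.2)
    {G : HilbertSpace K} (h : ∀ f, ⟪productVector hj f, G⟫_ℂ = 0) : G = 0 := by
  -- Balls of the sup norm are products of balls, so their indicators are product vectors.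
  have hball : ∀ (x : K → ℝ) (r : ℝ), 0 ≤ r → ∫ y in Metric.closedBall x r, G y = 0 := by
    intro x r hr
    have hfin : ∀ i, volume (Metric.closedBall (fun k => x (j i k)) r) ≠ ⊤ := fun i =>
      measure_closedBall_lt_top.ne
    have hfin' : volume (Metric.closedBall x r) ≠ ⊤ := measure_closedBall_lt_top.ne
    have key := h fun i => indicatorConstLp 2 (measurableSet_closedBall
      (x := fun k => x (j i k)) (ε := r)) (hfin i) (1 : ℂ)
    have e : productVector hj (fun i => indicatorConstLp 2 (measurableSet_closedBall
        (x := fun k => x (j i k)) (ε := r)) (hfin i) (1 : ℂ)) =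
        indicatorConstLp 2 (measurableSet_closedBall (x := x) (ε := r)) hfin' (1 : ℂ) := by
      symm
      rw [eq_productVector_iff]
      have h3 : ∀ᵐ y : K → ℝ, ∀ i, indicatorConstLp 2 (measurableSet_closedBall
          (x := fun k => x (j i k)) (ε := r)) (hfin i) (1 : ℂ) (fun k => y (j i k)) = _ :=
        ae_all_iff.2 fun i => (quasiMeasurePreserving_component hj i).ae
          (indicatorConstLp_coeFn (p := 2) (hs := measurableSet_closedBall
            (x := fun k => x (j i k)) (ε := r)) (hμs := hfin i) (c := (1 : ℂ)))
      filter_upwards [h3, indicatorConstLp_coeFn (p := 2) (hs := measurableSet_closedBall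
        (x := x) (ε := r)) (hμs := hfin') (c := (1 : ℂ))] with y h3 h4
      rw [h4, Finset.prod_congr rfl fun i _ => h3 i]
      by_cases hy : y ∈ Metric.closedBall x r
      · have h5 : ∀ i, (fun k => y (j i k)) ∈ Metric.closedBall (fun k => x (j i k)) r := fun i => by
          rw [Metric.mem_closedBall, dist_pi_le_iff hr] at hy ⊢
          exact fun k => hy _
        simp only [Set.indicator_of_mem hy, Set.indicator_of_mem (h5 _), Finset.prod_const_one]
      · obtain ⟨i, hi⟩ : ∃ i, (fun k => y (j i k)) ∉ Metric.closedBall (fun k => x (j i k)) r := by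
          by_contra! hc
          refine hy ?_
          rw [Metric.mem_closedBall, dist_pi_le_iff hr]
          intro k
          obtain ⟨⟨i, k⟩, rfl⟩ := hj.2 k
          exact (dist_pi_le_iff hr).1 (hc i) k
        rw [Set.indicator_of_notMem hy]
        exact (Finset.prod_eq_zero (Finset.mem_univ i) (by rw [Set.indicator_of_notMem hi])).symm
    rwa [e, L2.inner_indicatorConstLp_one] at key
  have hloc : LocallyIntegrable (G : (K → ℝ) → ℂ) volume :=
    (Lp.memLp G).locallyIntegrable (by norm_num)
  refine Lp.ext ?_
  -- Lebesgue differentiation: `G` is almost everywhere the limit of its averages over shrinking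
  -- balls, which all vanish.
  filter_upwards [IsUnifLocDoublingMeasure.ae_tendsto_average (μ := (volume : Measure (K → ℝ)))
    hloc 1, Lp.coeFn_zero ℂ 2 (volume : Measure (K → ℝ))] with x hx h0
  rw [h0, Pi.zero_apply]
  have h1 := hx (l := 𝓝[>] (0 : ℝ)) (fun _ => x) id tendsto_id (by
    filter_upwards [self_mem_nhdsWithin] with r hr
    simpa using (show (0 : ℝ) < r from hr).le)
  refine tendsto_nhds_unique h1 (tendsto_const_nhds.congr' ?_)
  filter_upwards [self_mem_nhdsWithin] with r hr
  rw [setAverage_eq, id, hball x r (show (0 : ℝ) < r from hr).le, smul_zero]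

end ProductVectors

/-! ### Tensor products of density operators -/

section TensorProducts

variable {ι : Type} [Fintype ι] {κ : ι → Type} {K : Type} [∀ i, Fintype (κ i)] [Fintype K]
  {j : ∀ i, κ i → K}

/-- The vectors `⨂ᵢ ρᵢ^{1/2} b_{Jᵢ}`. -/
noncomputable def productEnsemble (hj : Function.Bijective fun p : Σ i, κ i => j p.1 p.2)
    (ρ : ∀ i, DensityOperator (κ i))
    (J : ∀ i, (exists_hilbertBasis ℂ (HilbertSpace (κ i))).choose) : HilbertSpace K :=
  productVector hj fun i => (ρ i).sqrt (traceBasis (κ i) (J i))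

lemma hasSum_norm_productEnsemble_sq (hj : Function.Bijective fun p : Σ i, κ i => j p.1 p.2)
    (ρ : ∀ i, DensityOperator (κ i)) : HasSum (fun J => ‖productEnsemble hj ρ J‖ ^ 2) 1 := by
  have hi := fun i => (ρ i).hasSum_norm_sq (ρ i).isEnsemble
  have h := hasSum_pi_prod (f := fun i k => ((‖(ρ i).sqrt (traceBasis (κ i) k)‖ ^ 2 : ℝ) : ℂ))
    (a := fun _ => ((1 : ℝ) : ℂ)) (fun i => by
      simpa using (hi i).summable) (fun i => Complex.hasSum_ofReal.2 (hi i))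
  simp only [← Complex.ofReal_prod, Finset.prod_const_one, ← norm_productVector_sq hj] at h
  exact Complex.hasSum_ofReal.1 h

lemma IsEnsemble.summable_norm_mul {H J : Type*} [NormedAddCommGroup H] [InnerProductSpace ℂ H]
    {v : J → H} {T : H →L[ℂ] H} (h : IsEnsemble v T) (x y : H) :
    Summable fun k => ‖⟪x, v k⟫_ℂ * ⟪v k, y⟫_ℂ‖ := by
  refine Summable.of_nonneg_of_le (fun _ => norm_nonneg _) (fun k => ?_)
    (h.summable.mul_left (‖x‖ * ‖y‖))
  rw [norm_mul]
  calc _ ≤ (‖x‖ * ‖v k‖) * (‖v k‖ * ‖y‖) := by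
        gcongr <;> exact norm_inner_le_norm _ _
    _ = _ := by ring

/-- Tested against a product vector, the ensemble series for `τ` factors into the ensemble series of
the `ρᵢ`; totality of product vectors concludes. -/
lemma apply_productVector_of_isEnsemble (hj : Function.Bijective fun p : Σ i, κ i => j p.1 p.2)
    {ρ : ∀ i, DensityOperator (κ i)} {τ : DensityOperator K}
    (h : IsEnsemble (productEnsemble hj ρ) τ.op) (f : ∀ i, HilbertSpace (κ i)) :
    τ.op (productVector hj f) = productVector hj fun i => (ρ i).op (f i) := by
  rw [← sub_eq_zero]
  refine eq_zero_of_inner_productVector hj fun g => ?_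
  rw [inner_sub_right, sub_eq_zero, inner_productVector]
  refine (h.hasSum _ _).unique ?_
  have := hasSum_pi_prod (fun i => (ρ i).isEnsemble.summable_norm_mul (g i) (f i))
    (fun i => (ρ i).isEnsemble.hasSum (g i) (f i))
  simpa only [productEnsemble, inner_productVector, ← Finset.prod_mul_distrib] using this

lemma eq_of_apply_productVector (hj : Function.Bijective fun p : Σ i, κ i => j p.1 p.2)
    {τ τ' : DensityOperator K}
    (h : ∀ f, τ.op (productVector hj f) = τ'.op (productVector hj f)) : τ = τ' := by
  have h1 : ContinuousLinearMap.adjoint (τ.op - τ'.op) = 0 := by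
    ext1 G
    refine eq_zero_of_inner_productVector hj fun f => ?_
    rw [ContinuousLinearMap.adjoint_inner_right, _root_.sub_apply, h, sub_self,
      inner_zero_left]
  have h2 : τ.op - τ'.op = 0 := by
    rw [← ContinuousLinearMap.adjoint_adjoint (τ.op - τ'.op), h1, map_zero]
  exact DensityOperator.ext (sub_eq_zero.1 h2)

/-- By uniqueness, `τ` is the state built from the product ensemble, so it inherits that ensemble.
-/
lemma isEnsemble_of_apply_productVector
    (hj : Function.Bijective fun p : Σ i, κ i => j p.1 p.2)
    {ρ : ∀ i, DensityOperator (κ i)} {τ : DensityOperator K}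
    (h : ∀ f, τ.op (productVector hj f) = productVector hj fun i => (ρ i).op (f i)) :
    IsEnsemble (productEnsemble hj ρ) τ.op := by
  obtain ⟨τ', hτ'⟩ := exists_densityOperator (hasSum_norm_productEnsemble_sq hj ρ)
  rwa [eq_of_apply_productVector hj (τ := τ) (τ' := τ') fun f =>
    (h f).trans (apply_productVector_of_isEnsemble hj hτ' f).symm]

/-- The characteristic function of a tensor product is the product of the characteristic
functions. -/
lemma characteristicFunction_eq_prod (hj : Function.Bijective fun p : Σ i, κ i => j p.1 p.2)
    {ρ : ∀ i, DensityOperator (κ i)} {τ : DensityOperator K}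
    (h : ∀ f, τ.op (productVector hj f) = productVector hj fun i => (ρ i).op (f i))
    (r : PhaseSpace K) :
    characteristicFunction τ r =
      ∏ i, characteristicFunction (ρ i) fun p => r (Prod.map (j i) id p) := by
  rw [characteristicFunction_eq_tsum (isEnsemble_of_apply_productVector hj h)]
  simp only [productEnsemble, displacement_productVector, inner_productVector]
  refine (hasSum_pi_prod (f := fun i k => ⟪(ρ i).sqrt (traceBasis (κ i) k),
    displacement (fun p => r (j i p.1, p.2)) ((ρ i).sqrt (traceBasis (κ i) k))⟫_ℂ)
    (a := fun i => characteristicFunction (ρ i) fun p => r (Prod.map (j i) id p))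
    (fun i => ?_) fun i => ?_).tsum_eq
  · exact Summable.of_nonneg_of_le (fun _ => norm_nonneg _)
      (fun k => norm_inner_displacement_le _ _) (ρ i).isEnsemble.summable
  · rw [characteristicFunction_eq_tsum (ρ i).isEnsemble]
    exact (Summable.of_norm_bounded (ρ i).isEnsemble.summable
      fun k => norm_inner_displacement_le _ _).hasSum

/-! ### Tensor products regrouped as bipartite states -/

section Bipartite

variable {α β : ι → Type}

lemma bijective_modeEmb {ι : Type} {α β : ι → Type} :
    Function.Bijective fun p : Σ i, α i ⊕ β i => modeEmb (α := α) (β := β) p.1 p.2 := by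
  have : (fun p : Σ i, α i ⊕ β i => modeEmb (α := α) (β := β) p.1 p.2) =
      Equiv.sigmaSumDistrib α β := by
    funext ⟨i, k⟩
    cases k <;> rfl
  rw [this]
  exact (Equiv.sigmaSumDistrib α β).bijective

variable [∀ i, Fintype (α i)] [∀ i, Fintype (β i)]

lemma isTensorProduct_iff {ρ : ∀ i, DensityOperator (α i ⊕ β i)}
    {τ : DensityOperator ((Σ i, α i) ⊕ (Σ i, β i))} :
    IsTensorProduct ρ τ ↔ ∀ f, τ.op (productVector bijective_modeEmb f) =
      productVector bijective_modeEmb fun i => (ρ i).op (f i) := by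
  constructor
  · intro h f
    exact (eq_productVector_iff _ _ _).2 (h f _ (coeFn_productVector _ f))
  · intro h f F hF
    rw [(eq_productVector_iff bijective_modeEmb f F).2 hF, h f]
    exact coeFn_productVector _ _

lemma existsUnique_isTensorProduct (ρ : ∀ i, DensityOperator (α i ⊕ β i)) :
    ∃! τ, IsTensorProduct ρ τ := by
  obtain ⟨τ, hτ⟩ := exists_densityOperator (hasSum_norm_productEnsemble_sq bijective_modeEmb ρ)
  have h := apply_productVector_of_isEnsemble bijective_modeEmb hτ
  refine ⟨τ, isTensorProduct_iff.2 h, fun τ' hτ' => ?_⟩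
  exact eq_of_apply_productVector bijective_modeEmb fun f =>
    (isTensorProduct_iff.1 hτ' f).trans (h f).symm

end Bipartite

end TensorProducts

/-! ### States with Gaussian characteristic function are Gaussian -/

section Wigner

variable {α : Type} [Fintype α] [DecidableEq α]

/-- The volume-preserving substitution `r = -Ωw` turns the Wigner integral into the Fourier integral
of a Gaussian, evaluated at `d - s`. -/
lemma isGaussian_of_hasGaussianChar {ρ : DensityOperator α} {d : PhaseSpace α}
    {γ : Matrix (α × Fin 2) (α × Fin 2) ℝ} (hγ : γ.PosDef) (hρ : HasGaussianChar ρ d γ) :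
    IsGaussian ρ := by
  refine ⟨d, γ, hγ, fun s => ?_⟩
  -- Chosen so that `wᵀ δ⁻¹ w = wᵀγw / 4`; the transform then has exponent `(s - d)ᵀ γ⁻¹ (s - d)`.
  set δ : Matrix (α × Fin 2) (α × Fin 2) ℝ := (4 : ℝ) • γ⁻¹ with hδ
  have hδpos : δ.PosDef := hγ.inv.smul (by norm_num)
  have hdet : IsUnit γ.det := hγ.det_pos.ne'.isUnit
  have hδinv : δ⁻¹ = (1 / 4 : ℝ) • γ := by
    refine inv_eq_right_inv ?_
    rw [hδ, Matrix.smul_mul, Matrix.mul_smul, smul_smul, nonsing_inv_mul _ hdet]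
    norm_num
  have hdetO : (-Omega α).det ≠ 0 := by rw [det_neg_Omega]; exact one_ne_zero
  have h1 := integral_comp_mulVec hdetO fun r : PhaseSpace α => characteristicFunction ρ r *
    Complex.exp (Complex.I * ((r ⬝ᵥ (Omega α *ᵥ s) : ℝ) : ℂ))
  rw [det_neg_Omega, abs_one, inv_one, Complex.ofReal_one, one_mul] at h1
  have h2 := integral_gaussian_cexp hδpos 0 (d - s)
  have h3 : ∀ w : PhaseSpace α, characteristicFunction ρ (-Omega α *ᵥ w) *
      Complex.exp (Complex.I * (((-Omega α *ᵥ w) ⬝ᵥ (Omega α *ᵥ s) : ℝ) : ℂ)) =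
      ((Real.exp (-((w - 0) ⬝ᵥ (δ⁻¹ *ᵥ (w - 0)))) : ℝ) : ℂ) *
        Complex.exp (Complex.I * (((d - s) ⬝ᵥ w : ℝ) : ℂ)) := fun w => by
    rw [neg_mulVec, hρ, neg_dotProduct, dotProduct_Omega_mulVec, Omega_mulVec_Omega_mulVec, sub_zero,
      hδinv, smul_mulVec, dotProduct_smul, Complex.ofReal_exp, ← Complex.exp_add, ← Complex.exp_add,
      dotProduct_neg, sub_dotProduct, dotProduct_comm d, dotProduct_comm s, smul_eq_mul]
    congr 1
    push_cast
    ring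
  simp only [h3] at h1
  rw [wignerFunction, ← h1, h2]
  have hcard : (Fintype.card (α × Fin 2) / 2 : ℂ) = Fintype.card α := by
    simp [Fintype.card_prod]
  have hsq : Real.sqrt δ.det = 4 ^ Fintype.card α / Real.sqrt γ.det := by
    rw [hδ, det_smul, det_nonsing_inv, Ring.inverse_eq_inv', ← div_eq_mul_inv,
      Real.sqrt_div (by positivity), Fintype.card_prod, Fintype.card_fin, pow_mul,
      Real.sqrt_sq (by positivity)]
  have hquad : (d - s) ⬝ᵥ (δ *ᵥ (d - s)) / 4 = (s - d) ⬝ᵥ (γ⁻¹ *ᵥ (s - d)) := by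
    rw [hδ, smul_mulVec, dotProduct_smul, ← neg_sub s d, mulVec_neg, neg_dotProduct,
      dotProduct_neg, neg_neg, smul_eq_mul]
    ring
  rw [hcard, Complex.cpow_natCast, dotProduct_zero, hsq, hquad, Complex.ofReal_zero, mul_zero,
    zero_sub, ← Complex.ofReal_neg, ← Complex.ofReal_exp, ← Complex.ofReal_inv,
    ← Complex.ofReal_pow, ← Complex.ofReal_mul, ← Complex.ofReal_mul, ← Complex.ofReal_mul]
  congr 1
  have hd : 0 < Real.sqrt γ.det := Real.sqrt_pos.2 hγ.det_pos
  -- The constants combine as `(2π)^{-2m} · π^m · 4^m / √(det γ) = 1 / (π^m √(det γ))`.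
  rw [mul_pow, pow_mul, pow_mul, show (2 : ℝ) ^ 2 = 4 by norm_num, ← pow_mul, mul_comm 2, pow_mul]
  field_simp

end Wigner

/-! ### Direct sums of covariance matrices -/

section DirectSum

variable {ι : Type} [Fintype ι] [DecidableEq ι] {κ : ι → Type} {K : Type} [∀ i, Fintype (κ i)]
  [Fintype K] {j : ∀ i, κ i → K}

lemma bijective_prodMap (hj : Function.Bijective fun p : Σ i, κ i => j p.1 p.2) :
    Function.Bijective fun p : Σ i, κ i × Fin 2 => Prod.map (j p.1) (id : Fin 2 → Fin 2) p.2 := by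
  constructor
  · rintro ⟨i, k, a⟩ ⟨i', k', a'⟩ h
    obtain ⟨h1, h2⟩ := Prod.ext_iff.1 h
    have h3 := hj.1 (a₁ := ⟨i, k⟩) (a₂ := ⟨i', k'⟩) h1
    cases h3
    cases (show a = a' from h2)
    rfl
  · rintro ⟨k, a⟩
    obtain ⟨⟨i, k⟩, rfl⟩ := hj.2 k
    exact ⟨⟨i, k, a⟩, rfl⟩

/-- The direct sum of matrices indexed by the quadratures of the subsystems. -/
noncomputable def directSum (hj : Function.Bijective fun p : Σ i, κ i => j p.1 p.2)
    (γ : ∀ i, Matrix (κ i × Fin 2) (κ i × Fin 2) ℝ) : Matrix (K × Fin 2) (K × Fin 2) ℝ :=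
  (blockDiagonal' γ).submatrix (Equiv.ofBijective _ (bijective_prodMap hj)).symm
    (Equiv.ofBijective _ (bijective_prodMap hj)).symm

lemma ofBijective_symm_prodMap (hj : Function.Bijective fun p : Σ i, κ i => j p.1 p.2) (i : ι)
    (k : κ i × Fin 2) :
    (Equiv.ofBijective _ (bijective_prodMap hj)).symm (Prod.map (j i) id k) = ⟨i, k⟩ :=
  (Equiv.ofBijective _ (bijective_prodMap hj)).symm_apply_apply ⟨i, k⟩

lemma directSum_apply_same (hj : Function.Bijective fun p : Σ i, κ i => j p.1 p.2)
    (γ : ∀ i, Matrix (κ i × Fin 2) (κ i × Fin 2) ℝ) (i : ι) (k l : κ i × Fin 2) :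
    directSum hj γ (Prod.map (j i) id k) (Prod.map (j i) id l) = γ i k l := by
  rw [directSum, submatrix_apply, ofBijective_symm_prodMap hj, ofBijective_symm_prodMap hj,
    blockDiagonal'_apply_eq]

lemma directSum_apply_ne (hj : Function.Bijective fun p : Σ i, κ i => j p.1 p.2)
    (γ : ∀ i, Matrix (κ i × Fin 2) (κ i × Fin 2) ℝ) {i i' : ι} (h : i ≠ i')
    (k : κ i × Fin 2) (l : κ i' × Fin 2) :
    directSum hj γ (Prod.map (j i) id k) (Prod.map (j i') id l) = 0 := by
  rw [directSum, submatrix_apply, ofBijective_symm_prodMap hj, ofBijective_symm_prodMap hj,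
    blockDiagonal'_apply_ne _ _ _ h]

lemma dotProduct_eq_sum (hj : Function.Bijective fun p : Σ i, κ i => j p.1 p.2)
    (x y : PhaseSpace K) :
    x ⬝ᵥ y = ∑ i, (fun p => x (Prod.map (j i) id p)) ⬝ᵥ (fun p => y (Prod.map (j i) id p)) :=
  sum_eq_sum_sum (j := fun i => Prod.map (j i) id) (bijective_prodMap hj) fun p => x p * y p

lemma directSum_mulVec (hj : Function.Bijective fun p : Σ i, κ i => j p.1 p.2)
    (γ : ∀ i, Matrix (κ i × Fin 2) (κ i × Fin 2) ℝ) (y : PhaseSpace K) (i : ι) :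
    (fun p => (directSum hj γ *ᵥ y) (Prod.map (j i) id p)) =
      γ i *ᵥ fun p => y (Prod.map (j i) id p) := by
  funext k
  rw [mulVec, dotProduct_eq_sum hj, Fintype.sum_eq_single i]
  · simp only [directSum_apply_same]
    rfl
  · intro i' hi'
    simp only [directSum_apply_ne hj γ hi'.symm]
    exact zero_dotProduct _

lemma dotProduct_directSum_mulVec (hj : Function.Bijective fun p : Σ i, κ i => j p.1 p.2)
    (γ : ∀ i, Matrix (κ i × Fin 2) (κ i × Fin 2) ℝ) (x y : PhaseSpace K) :
    x ⬝ᵥ (directSum hj γ *ᵥ y) = ∑ i, (fun p => x (Prod.map (j i) id p)) ⬝ᵥ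
      (γ i *ᵥ fun p => y (Prod.map (j i) id p)) := by
  rw [dotProduct_eq_sum hj]
  simp only [directSum_mulVec]

lemma posDef_directSum (hj : Function.Bijective fun p : Σ i, κ i => j p.1 p.2)
    {γ : ∀ i, Matrix (κ i × Fin 2) (κ i × Fin 2) ℝ} (hγ : ∀ i, (γ i).PosDef) :
    (directSum hj γ).PosDef := by
  have hs : (blockDiagonal' γ).IsHermitian := by
    rw [Matrix.IsHermitian, blockDiagonal'_conjTranspose]
    congr 1
    funext i
    exact (hγ i).1
  refine PosDef.of_dotProduct_mulVec_pos (hs.submatrix _) fun x hx => ?_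
  rw [star_trivial, dotProduct_directSum_mulVec]
  obtain ⟨p, hp⟩ := Function.ne_iff.1 hx
  obtain ⟨⟨i, k⟩, rfl⟩ := (bijective_prodMap hj).2 p
  refine Finset.sum_pos' (fun i _ => ?_) ⟨i, Finset.mem_univ i, ?_⟩
  · simpa using (hγ i).posSemidef.dotProduct_mulVec_nonneg fun p => x (Prod.map (j i) id p)
  · simpa using (hγ i).dotProduct_mulVec_pos (x := fun p => x (Prod.map (j i) id p))
      fun h => hp (congrFun h k)

variable [DecidableEq K] [∀ i, DecidableEq (κ i)]

/-- Characteristic functions multiply and `Ω` is block diagonal, so the exponents add up to those of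
the direct sum, with the first moments glued together. -/
lemma hasGaussianChar_of_apply_productVector
    (hj : Function.Bijective fun p : Σ i, κ i => j p.1 p.2)
    {ρ : ∀ i, DensityOperator (κ i)} {τ : DensityOperator K}
    (h : ∀ f, τ.op (productVector hj f) = productVector hj fun i => (ρ i).op (f i))
    {d : ∀ i, PhaseSpace (κ i)} {γ : ∀ i, Matrix (κ i × Fin 2) (κ i × Fin 2) ℝ}
    (hρ : ∀ i, HasGaussianChar (ρ i) (d i) (γ i)) :
    ∃ D, HasGaussianChar τ D (directSum hj γ) := by
  refine ⟨(splitEquiv (j := fun i => Prod.map (j i) id) (bijective_prodMap hj)).symm d,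
    fun w => ?_⟩
  have hO : ∀ i, (fun p => (-(Omega K *ᵥ w)) (Prod.map (j i) id p)) =
      -(Omega (κ i) *ᵥ fun p => w (Prod.map (j i) id p)) := fun i => by
    funext ⟨k, a⟩
    fin_cases a <;>
      simp [Omega, Matrix.mulVec, dotProduct, Fintype.sum_prod_type, Matrix.one_apply]
  have hd : ∀ i, (fun p => (splitEquiv (j := fun i => Prod.map (j i) id)
      (bijective_prodMap hj)).symm d (Prod.map (j i) id p)) = d i := fun i =>
    congrFun ((splitEquiv (j := fun i => Prod.map (j i) id)
      (bijective_prodMap hj)).apply_symm_apply d) i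
  rw [characteristicFunction_eq_prod hj h]
  simp only [hO, fun i => hρ i fun p => w (Prod.map (j i) id p)]
  rw [← Complex.exp_sum, dotProduct_directSum_mulVec, dotProduct_eq_sum hj]
  simp only [hd, Finset.sum_sub_distrib, ← Finset.mul_sum, ← Finset.sum_div, ← Complex.ofReal_sum]

end DirectSum

/-! ### Tensorization -/

section Tensorization

variable {ι : Type} [Fintype ι] [DecidableEq ι] {α β : ι → Type}
  [∀ i, Fintype (α i)] [∀ i, Fintype (β i)]

lemma dotProduct_blockA_directSum
    (γ : ∀ i, Matrix ((α i ⊕ β i) × Fin 2) ((α i ⊕ β i) × Fin 2) ℝ)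
    (x y : PhaseSpace (Σ i, α i)) :
    x ⬝ᵥ (blockA (directSum bijective_modeEmb γ) *ᵥ y) =
      ∑ i, (fun q : α i × Fin 2 => x (⟨i, q.1⟩, q.2)) ⬝ᵥ
        (blockA (γ i) *ᵥ fun q : α i × Fin 2 => y (⟨i, q.1⟩, q.2)) := by
  have h : ∀ (x : PhaseSpace (Σ i, α i)) i, (fun p => (leftCoeff x :
      PhaseSpace ((Σ i, α i) ⊕ (Σ i, β i))) (Prod.map (modeEmb i) id p)) =
      leftCoeff fun q : α i × Fin 2 => x (⟨i, q.1⟩, q.2) := fun x i => by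
    funext ⟨k, a⟩
    cases k <;> rfl
  rw [← leftCoeff_dotProduct_left, dotProduct_directSum_mulVec]
  simp only [h, leftCoeff_dotProduct_left]

lemma dotProduct_blockB_directSum
    (γ : ∀ i, Matrix ((α i ⊕ β i) × Fin 2) ((α i ⊕ β i) × Fin 2) ℝ)
    (x y : PhaseSpace (Σ i, β i)) :
    x ⬝ᵥ (blockB (directSum bijective_modeEmb γ) *ᵥ y) =
      ∑ i, (fun q : β i × Fin 2 => x (⟨i, q.1⟩, q.2)) ⬝ᵥ
        (blockB (γ i) *ᵥ fun q : β i × Fin 2 => y (⟨i, q.1⟩, q.2)) := by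
  have h : ∀ (x : PhaseSpace (Σ i, β i)) i, (fun p => (rightCoeff x :
      PhaseSpace ((Σ i, α i) ⊕ (Σ i, β i))) (Prod.map (modeEmb i) id p)) =
      rightCoeff fun q : β i × Fin 2 => x (⟨i, q.1⟩, q.2) := fun x i => by
    funext ⟨k, a⟩
    cases k <;> rfl
  rw [← rightCoeff_dotProduct_right, dotProduct_directSum_mulVec]
  simp only [h, rightCoeff_dotProduct_right]

lemma dotProduct_blockAB_directSum
    (γ : ∀ i, Matrix ((α i ⊕ β i) × Fin 2) ((α i ⊕ β i) × Fin 2) ℝ)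
    (x : PhaseSpace (Σ i, α i)) (y : PhaseSpace (Σ i, β i)) :
    x ⬝ᵥ (blockAB (directSum bijective_modeEmb γ) *ᵥ y) =
      ∑ i, (fun q : α i × Fin 2 => x (⟨i, q.1⟩, q.2)) ⬝ᵥ
        (blockAB (γ i) *ᵥ fun q : β i × Fin 2 => y (⟨i, q.1⟩, q.2)) := by
  have h : ∀ (x : PhaseSpace (Σ i, α i)) i, (fun p => (leftCoeff x :
      PhaseSpace ((Σ i, α i) ⊕ (Σ i, β i))) (Prod.map (modeEmb i) id p)) =
      leftCoeff fun q : α i × Fin 2 => x (⟨i, q.1⟩, q.2) := fun x i => by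
    funext ⟨k, a⟩
    cases k <;> rfl
  have h' : ∀ (x : PhaseSpace (Σ i, β i)) i, (fun p => (rightCoeff x :
      PhaseSpace ((Σ i, α i) ⊕ (Σ i, β i))) (Prod.map (modeEmb i) id p)) =
      rightCoeff fun q : β i × Fin 2 => x (⟨i, q.1⟩, q.2) := fun x i => by
    funext ⟨k, a⟩
    cases k <;> rfl
  rw [← leftCoeff_dotProduct_right, dotProduct_directSum_mulVec]
  simp only [h, h', leftCoeff_dotProduct_right]

/-- The maximum is reached by an optimal pair of block `i₀` padded with zeros. For the upper bound,
each block contributes at most `μ i₀ √pᵢ √qᵢ`, and Cauchy-Schwarz over the blocks uses `∑ pᵢ = ∑ qᵢ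
= 2`. -/
lemma isGreatest_normalizedValues_directSum
    {γ : ∀ i, Matrix ((α i ⊕ β i) × Fin 2) ((α i ⊕ β i) × Fin 2) ℝ} (hγ : ∀ i, (γ i).PosDef)
    {μ : ι → ℝ}
    (hμ : ∀ i, IsGreatest (normalizedValues (blockA (γ i)) (blockB (γ i)) (blockAB (γ i))) (μ i))
    {i₀ : ι} (hi₀ : ∀ i, μ i ≤ μ i₀) :
    IsGreatest (normalizedValues (blockA (directSum bijective_modeEmb γ))
      (blockB (directSum bijective_modeEmb γ)) (blockAB (directSum bijective_modeEmb γ)))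
      (μ i₀) := by
  classical
  constructor
  · obtain ⟨x, y, hx, hy, hxy⟩ := (hμ i₀).1
    let X : ∀ i, PhaseSpace (α i) := Pi.single i₀ x
    let Y : ∀ i, PhaseSpace (β i) := Pi.single i₀ y
    have hX : X i₀ = x := Pi.single_eq_same _ _
    have hY : Y i₀ = y := Pi.single_eq_same _ _
    have hX0 : ∀ i, i ≠ i₀ → X i = 0 := fun i hi => Pi.single_eq_of_ne hi _
    refine ⟨fun p => X p.1.1 (p.1.2, p.2), fun p => Y p.1.1 (p.1.2, p.2), ?_, ?_, ?_⟩
    · rw [dotProduct_blockA_directSum, Fintype.sum_eq_single i₀]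
      · change X i₀ ⬝ᵥ (_ *ᵥ X i₀) = 2
        rw [hX, hx]
      · intro i hi
        change X i ⬝ᵥ _ = 0
        rw [hX0 i hi, zero_dotProduct]
    · rw [dotProduct_blockB_directSum, Fintype.sum_eq_single i₀]
      · change Y i₀ ⬝ᵥ (_ *ᵥ Y i₀) = 2
        rw [hY, hy]
      · intro i hi
        change Y i ⬝ᵥ _ = 0
        rw [show Y i = 0 from Pi.single_eq_of_ne hi _, zero_dotProduct]
    · rw [dotProduct_blockAB_directSum, Fintype.sum_eq_single i₀]
      · change _ = X i₀ ⬝ᵥ (_ *ᵥ Y i₀) / 2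
        rw [hX, hY, hxy]
      · intro i hi
        change X i ⬝ᵥ _ = 0
        rw [hX0 i hi, zero_dotProduct]
  · rintro v ⟨x, y, hx, hy, rfl⟩
    rw [dotProduct_blockA_directSum] at hx
    rw [dotProduct_blockB_directSum] at hy
    rw [dotProduct_blockAB_directSum]
    set p : ι → ℝ := fun i => (fun q : α i × Fin 2 => x (⟨i, q.1⟩, q.2)) ⬝ᵥ
        (blockA (γ i) *ᵥ fun q : α i × Fin 2 => x (⟨i, q.1⟩, q.2)) with hp
    set q : ι → ℝ := fun i => (fun q : β i × Fin 2 => y (⟨i, q.1⟩, q.2)) ⬝ᵥ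
        (blockB (γ i) *ᵥ fun q : β i × Fin 2 => y (⟨i, q.1⟩, q.2)) with hq
    have hp0 : ∀ i, 0 ≤ p i := fun i => by
      simpa using (posDef_blockA (hγ i)).posSemidef.dotProduct_mulVec_nonneg
        fun q : α i × Fin 2 => x (⟨i, q.1⟩, q.2)
    have hq0 : ∀ i, 0 ≤ q i := fun i => by
      simpa using (posDef_blockB (hγ i)).posSemidef.dotProduct_mulVec_nonneg
        fun q : β i × Fin 2 => y (⟨i, q.1⟩, q.2)
    -- Nonnegativity allows multiplying the Cauchy-Schwarz inequality by `μ i₀`.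
    have h0 := nonneg_of_isGreatest_normalizedValues (hμ i₀)
    rw [div_le_iff₀ two_pos]
    calc _ ≤ ∑ i, μ i₀ * (Real.sqrt (p i) * Real.sqrt (q i)) := by
          refine Finset.sum_le_sum fun i _ => ?_
          refine (dotProduct_mulVec_le_of_isGreatest (posDef_blockA (hγ i)) (posDef_blockB (hγ i))
            (hμ i) _ _).trans ?_
          exact mul_le_mul_of_nonneg_right (hi₀ i) (by positivity)
      _ = μ i₀ * ∑ i, Real.sqrt (p i) * Real.sqrt (q i) := by rw [Finset.mul_sum]
      _ ≤ μ i₀ * (Real.sqrt (∑ i, p i) * Real.sqrt (∑ i, q i)) := by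
          gcongr
          exact Real.sum_sqrt_mul_sqrt_le _ hp0 hq0
      _ = μ i₀ * 2 := by rw [hx, hy, Real.mul_self_sqrt (by norm_num)]

variable [Nonempty ι] [∀ i, DecidableEq (α i)] [∀ i, Nonempty (α i)] [∀ i, DecidableEq (β i)]
  [∀ i, Nonempty (β i)]

lemma tensorization {ρ : ∀ i, DensityOperator (α i ⊕ β i)} (hρ : ∀ i, IsGaussian (ρ i))
    {τ : DensityOperator ((Σ i, α i) ⊕ (Σ i, β i))} (hτ : IsTensorProduct ρ τ) :
    IsGaussian τ ∧ IsDirectSum (fun i => covarianceMatrix (ρ i)) (covarianceMatrix τ) ∧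
      IsGreatest (Set.range fun i => gaussianMaximalCorrelation (ρ i))
        (gaussianMaximalCorrelation τ) := by
  choose d hγ hχ using fun i => (hρ i).exists_hasGaussianChar
  obtain ⟨D, hD⟩ := hasGaussianChar_of_apply_productVector bijective_modeEmb
    (isTensorProduct_iff.1 hτ) hχ
  have hΓ := posDef_directSum (bijective_modeEmb (α := α) (β := β)) hγ
  refine ⟨isGaussian_of_hasGaussianChar hΓ hD, ?_, ?_⟩
  · rw [covarianceMatrix_eq (isSymm_of_posDef hΓ) hD]
    exact ⟨fun i k l => directSum_apply_same (bijective_modeEmb (α := α) (β := β)) _ i k l,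
      fun i i' h k l => directSum_apply_ne (bijective_modeEmb (α := α) (β := β)) _ h k l⟩
  · obtain ⟨i₀, hi₀⟩ := Finite.exists_max fun i => gaussianMaximalCorrelation (ρ i)
    have hne : Nonempty (Σ i, α i) := ⟨⟨i₀, Classical.arbitrary _⟩⟩
    have hne' : Nonempty (Σ i, β i) := ⟨⟨i₀, Classical.arbitrary _⟩⟩
    have h := isGreatest_normalizedValues_directSum hγ
      (fun i => isGreatest_gaussianMaximalCorrelation (hγ i) (hχ i)) hi₀
    rw [(isGreatest_gaussianMaximalCorrelation hΓ hD).unique h]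
    refine ⟨⟨i₀, rfl⟩, ?_⟩
    rintro _ ⟨i, rfl⟩
    exact hi₀ i

end Tensorization

end GaussianCorrelation

theorem mainTheorem7 :
    -- the norm formula, for Gaussian states with arbitrarily many modes on each side
    (∀ (α β : Type) [Fintype α] [DecidableEq α] [Nonempty α]
        [Fintype β] [DecidableEq β] [Nonempty β]
        (ρ : GaussianCorrelation.DensityOperator (α ⊕ β)), GaussianCorrelation.IsGaussian ρ →
      (∀ u, GaussianCorrelation.HasSecondMoment ρ (GaussianCorrelation.quadrature u)) ∧
      (GaussianCorrelation.covarianceMatrix ρ).PosDef ∧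
      IsGreatest (GaussianCorrelation.correlationValues ρ)
        (GaussianCorrelation.gaussianMaximalCorrelation ρ) ∧
      GaussianCorrelation.gaussianMaximalCorrelation ρ =
        GaussianCorrelation.matrixOpNorm
          (GaussianCorrelation.invSqrt
              (GaussianCorrelation.blockA (GaussianCorrelation.covarianceMatrix ρ)) *
            GaussianCorrelation.blockAB (GaussianCorrelation.covarianceMatrix ρ) *
            GaussianCorrelation.invSqrt
              (GaussianCorrelation.blockB (GaussianCorrelation.covarianceMatrix ρ)))) ∧
    -- the value for two-mode Gaussian states in standard form
    (∀ ρ : GaussianCorrelation.DensityOperator (Unit ⊕ Unit), GaussianCorrelation.IsGaussian ρ →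
      ∀ lamA lamB ν₁ ν₂ : ℝ,
        GaussianCorrelation.covarianceMatrix ρ =
          GaussianCorrelation.standardForm lamA lamB ν₁ ν₂ →
        |ν₂| ≤ |ν₁| →
        GaussianCorrelation.gaussianMaximalCorrelation ρ = |ν₁| / Real.sqrt (lamA * lamB)) ∧
    -- tensor products of states exist and are unique
    (∀ (ι : Type) [Fintype ι] (α β : ι → Type)
        [∀ i, Fintype (α i)] [∀ i, Fintype (β i)]
        (ρ : ∀ i, GaussianCorrelation.DensityOperator (α i ⊕ β i)),
      ∃! τ, GaussianCorrelation.IsTensorProduct ρ τ) ∧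
    -- tensorization, for tensor products of Gaussian states
    (∀ (ι : Type) [Fintype ι] [DecidableEq ι] [Nonempty ι] (α β : ι → Type)
        [∀ i, Fintype (α i)] [∀ i, DecidableEq (α i)] [∀ i, Nonempty (α i)]
        [∀ i, Fintype (β i)] [∀ i, DecidableEq (β i)] [∀ i, Nonempty (β i)]
        (ρ : ∀ i, GaussianCorrelation.DensityOperator (α i ⊕ β i)),
      (∀ i, GaussianCorrelation.IsGaussian (ρ i)) →
      ∀ τ, GaussianCorrelation.IsTensorProduct ρ τ →
        GaussianCorrelation.IsGaussian τ ∧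
        GaussianCorrelation.IsDirectSum (fun i => GaussianCorrelation.covarianceMatrix (ρ i))
          (GaussianCorrelation.covarianceMatrix τ) ∧
        IsGreatest (Set.range fun i => GaussianCorrelation.gaussianMaximalCorrelation (ρ i))
          (GaussianCorrelation.gaussianMaximalCorrelation τ)) ∧
    -- tensorization, for `n` copies of a Gaussian state
    (∀ (α β : Type) [Fintype α] [DecidableEq α] [Nonempty α]
        [Fintype β] [DecidableEq β] [Nonempty β]
        (ρ : GaussianCorrelation.DensityOperator (α ⊕ β)), GaussianCorrelation.IsGaussian ρ →
      ∀ n : ℕ, 0 < n →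
      ∀ τ : GaussianCorrelation.DensityOperator ((Σ _ : Fin n, α) ⊕ (Σ _ : Fin n, β)),
        GaussianCorrelation.IsTensorProduct (fun _ : Fin n => ρ) τ →
        GaussianCorrelation.gaussianMaximalCorrelation τ =
          GaussianCorrelation.gaussianMaximalCorrelation ρ) := by
  refine ⟨fun α β _ _ _ _ _ _ ρ h => ?_, fun ρ h lamA lamB ν₁ ν₂ hst hν => ?_,
    fun ι _ α β _ _ ρ => GaussianCorrelation.existsUnique_isTensorProduct ρ,
    fun ι _ _ _ α β _ _ _ _ _ _ ρ hρ τ hτ => GaussianCorrelation.tensorization hρ hτ,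
    fun α β _ _ _ _ _ _ ρ h n hn τ hτ => ?_⟩
  · obtain ⟨d, hγ, hχ⟩ := h.exists_hasGaussianChar
    have hs := GaussianCorrelation.isSymm_of_posDef hγ
    refine ⟨fun u => GaussianCorrelation.hasSecondMoment_quadrature hs hχ u, hγ, ?_,
      GaussianCorrelation.gaussianMaximalCorrelation_eq_opNorm hγ hχ⟩
    rw [GaussianCorrelation.correlationValues_eq hs hχ]
    exact GaussianCorrelation.isGreatest_gaussianMaximalCorrelation hγ hχ
  · obtain ⟨d, hγ, hχ⟩ := h.exists_hasGaussianChar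
    rw [hst] at hγ hχ
    exact GaussianCorrelation.gaussianMaximalCorrelation_standardForm hγ hχ hν
  · have : Nonempty (Fin n) := ⟨⟨0, hn⟩⟩
    -- A maximum over a constant nonempty family is its common value.
    obtain ⟨_, hi⟩ := (GaussianCorrelation.tensorization (fun _ => h) hτ).2.2.1
    exact hi.symm
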